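/- Conventions. Ideals of $C^*$-algebras are closed and two-sided, and a $C^*$-algebra is simple if it is nonzero and has no ideals other than $0$ and itself. For a $C^*$-algebra $A$ let $A_\infty=\ell^\infty(\mathbb N,A)/c_0(\mathbb N,A)$, with quotient map $\eta_A$, and view $A\subseteq A_\infty$ as constant sequences. Let $\alpha\colon G\to\mathrm{Aut}(A)$ be a (point-norm) continuous action of a second-countable compact (Hausdorff) group. For an $\alpha$-invariant $C^*$-subalgebra $D\subseteq A$ set $F(D,A)=(A_\infty\cap D')/\mathrm{Ann}(D,A_\infty)$, with quotient map $\kappa_{D,A}$ and the induced action $F(\alpha)$ of $G$. Let $A_{\infty,\alpha}\subseteq A_\infty$ be the image under $\eta_A$ of those $a\in\ell^\infty(\mathbb N,A)$ for which $g\mapsto(\alpha_g(a_n))_n$ is norm continuous, and let $F_\alpha(D,A)=\kappa_{D,A}(A_{\infty,\alpha}\cap D')$. If $A$ is $\sigma$-unital (has a countable approximate unit), $\alpha$ has the *Rokhlin property* if for every separable $\alpha$-invariant $C^*$-subalgebra $D\subseteq A$ there is a unital $G$-equivariant $*$-homomorphism from $C(G)$, with the left translation action $(\mathrm{Lt}_gf)(h)=f(g^{-1}h)$,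 to $(F_\alpha(D,A),F(\alpha))$. Write $A^\alpha$ for the fixed point algebra. The crossed product $A\rtimes_\alpha G$ is the enveloping $C^*$-algebra of $L^1(G,A,\alpha)$ (equivalently, the completion of $C(G,A)$, with twisted convolution, in the largest $C^*$-seminorm dominated by the $L^1$-norm, which is a norm). For an $\alpha$-invariant ideal $J$ of $A$, the crossed product $J\rtimes_\alpha G$ is identified with the closure of $C(G,J)$ in $A\rtimes_\alpha G$. **Theorem.** Let $A$ be a $\sigma$-unital $C^*$-algebra, let $G$ be a second-countable compact group, and let $\alpha\colon G\to\mathrm{Aut}(A)$ be a continuous action with the Rokhlin property. 1. If $I$ is an ideal in $A^\alpha$, then there exists an $\alpha$-invariant ideal $J$ in $A$ such that $I=J\cap A^\alpha$. 2. If $I$ is an ideal in $A\rtimes_\alpha G$, then there exists an $\alpha$-invariant ideal $J$ in $A$ such that $I=J\rtimes_\alpha G$. 3. If $A$ is simple, then so are $A^\alpha$ and $A\rtimes_\alpha G$. -/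

import Mathlib

open MeasureTheory Topology Filter UniformSpace
open scoped BoundedContinuousFunction

universe u v

noncomputable section

/-! ### `C^*`-algebraic preliminaries -/

/-- `A` is `σ`-unital: it has a countable approximate unit consisting of positive contractions. -/
def IsSigmaUnital (A : Type u) [NonUnitalCStarAlgebra A] : Prop :=
  ∃ e : ℕ → A, (∀ n, ‖e n‖ ≤ 1) ∧ (∀ n, ∃ b : A, e n = star b * b) ∧
    (Filter.map e atTop).IsApproximateUnit

/-- Simplicity of a topological algebra, as for `C^*`-algebras: it is nonzero, and the only closed
two-sided ideals are zero and the whole algebra.  (In a `C^*`-algebra, closed two-sided ring ideals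
are automatically complex subspaces and self-adjoint, because of approximate units.) -/
def IsTopSimple (B : Type u) [NonUnitalRing B] [TopologicalSpace B] : Prop :=
  Nontrivial B ∧ ∀ I : TwoSidedIdeal B, IsClosed (I : Set B) → I = ⊥ ∨ I = ⊤

/-- A (point-norm) continuous action of `G` on the `C^*`-algebra `A` by `*`-automorphisms. -/
structure CStarAction (G : Type v) (A : Type u) [Group G] [TopologicalSpace G]
    [NonUnitalCStarAlgebra A] where
  /-- the homomorphism from `G` to the automorphism group of `A` -/
  toHom : G →* (A ≃⋆ₐ[ℂ] A)
  continuous_apply : ∀ a : A, Continuous fun g => toHom g a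

namespace CStarAction

variable {G : Type v} {A : Type u} [Group G] [TopologicalSpace G] [NonUnitalCStarAlgebra A]

instance : CoeFun (CStarAction G A) fun _ => G → (A ≃⋆ₐ[ℂ] A) := ⟨fun α => α.toHom⟩

variable (α : CStarAction G A)

theorem mul_apply (g h : G) (a : A) : α (g * h) a = α g (α h a) := by
  rw [map_mul]; rfl

theorem one_apply (a : A) : α 1 a = a := by
  rw [map_one]; rfl

theorem norm_apply (g : G) (a : A) : ‖α g a‖ = ‖a‖ :=
  NonUnitalStarAlgHom.norm_map (α g) (α g).injective a

theorem isometry_apply (g : G) : Isometry (α g) :=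
  AddMonoidHomClass.isometry_of_norm (α g) (α.norm_apply g)

theorem continuous_uncurry : Continuous fun p : G × A => α p.1 p.2 :=
  continuous_prod_of_continuous_lipschitzWith' (fun p : G × A => α p.1 p.2) 1
    (fun g => (α.isometry_apply g).lipschitz) (fun a => α.continuous_apply a)

/-- The fixed point algebra `A^α`. -/
def fixedPoints : NonUnitalStarSubalgebra ℂ A where
  carrier := {a | ∀ g, α g a = a}
  add_mem' {a b} ha hb g := by rw [map_add, ha g, hb g]
  zero_mem' g := map_zero _
  mul_mem' {a b} ha hb g := by rw [map_mul, ha g, hb g]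
  smul_mem' c a ha g := by rw [map_smul, ha g]
  star_mem' {a} ha g := by rw [map_star, ha g]

/-- The set `S` is invariant under the action. -/
def IsInvariant (S : Set A) : Prop := ∀ g, ∀ a ∈ S, α g a ∈ S

end CStarAction

/-! ### Quotients of `*`-algebras -/

/-- Self-adjoint two-sided ideals of a complex `*`-algebra. -/
structure StarIdeal (B : Type u) [NonUnitalRing B] [StarRing B] [Module ℂ B] extends
    Submodule ℂ B where
  mul_left_mem : ∀ b x : B, x ∈ carrier → b * x ∈ carrier
  mul_right_mem : ∀ b x : B, x ∈ carrier → x * b ∈ carrier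
  star_mem : ∀ x : B, x ∈ carrier → star x ∈ carrier

namespace StarIdeal

variable {B : Type u} [NonUnitalRing B] [StarRing B] [Module ℂ B]

/-- The quotient `B / I`. -/
def Quotient (I : StarIdeal B) : Type u := B ⧸ I.toSubmodule

variable (I : StarIdeal B)

instance : AddCommGroup I.Quotient := inferInstanceAs (AddCommGroup (B ⧸ I.toSubmodule))
instance : Module ℂ I.Quotient := inferInstanceAs (Module ℂ (B ⧸ I.toSubmodule))

/-- The quotient map as a linear map. -/
def mkₗ : B →ₗ[ℂ] I.Quotient := I.toSubmodule.mkQ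

theorem mkₗ_surjective : Function.Surjective I.mkₗ := Submodule.mkQ_surjective _

theorem mkₗ_eq_iff {x y : B} : I.mkₗ x = I.mkₗ y ↔ x - y ∈ I.toSubmodule :=
  Submodule.Quotient.eq _

instance : Mul I.Quotient where
  mul := Quotient.map₂ (· * ·) (by
    intro a b hab c d hcd
    rw [← Quotient.eq_iff_equiv] at hab hcd ⊢
    have h1 := (Submodule.Quotient.eq I.toSubmodule).1 hab
    have h2 := (Submodule.Quotient.eq I.toSubmodule).1 hcd
    refine (Submodule.Quotient.eq I.toSubmodule).2 ?_
    have : a * c - b * d = (a - b) * c + b * (c - d) := by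
      rw [sub_mul, mul_sub]; abel
    rw [this]
    exact I.toSubmodule.add_mem (I.mul_right_mem _ _ h1) (I.mul_left_mem _ _ h2))

theorem mkₗ_mul (a b : B) : I.mkₗ (a * b) = I.mkₗ a * I.mkₗ b := rfl

instance : Star I.Quotient where
  star := Quotient.map star (by
    intro a b hab
    rw [← Quotient.eq_iff_equiv] at hab ⊢
    have h1 := (Submodule.Quotient.eq I.toSubmodule).1 hab
    refine (Submodule.Quotient.eq I.toSubmodule).2 ?_
    rw [← star_sub]
    exact I.star_mem _ h1)

theorem mkₗ_star (a : B) : I.mkₗ (star a) = star (I.mkₗ a) := rfl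

instance : NonUnitalRing I.Quotient :=
  { (inferInstance : AddCommGroup I.Quotient), (inferInstance : Mul I.Quotient) with
    left_distrib := fun a b c => by
      obtain ⟨a, rfl⟩ := I.mkₗ_surjective a
      obtain ⟨b, rfl⟩ := I.mkₗ_surjective b
      obtain ⟨c, rfl⟩ := I.mkₗ_surjective c
      rw [← map_add, ← mkₗ_mul, ← mkₗ_mul, ← mkₗ_mul, ← map_add, mul_add]
    right_distrib := fun a b c => by
      obtain ⟨a, rfl⟩ := I.mkₗ_surjective a
      obtain ⟨b, rfl⟩ := I.mkₗ_surjective b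
      obtain ⟨c, rfl⟩ := I.mkₗ_surjective c
      rw [← map_add, ← mkₗ_mul, ← mkₗ_mul, ← mkₗ_mul, ← map_add, add_mul]
    zero_mul := fun a => by
      obtain ⟨a, rfl⟩ := I.mkₗ_surjective a
      rw [← map_zero I.mkₗ, ← mkₗ_mul, zero_mul]
    mul_zero := fun a => by
      obtain ⟨a, rfl⟩ := I.mkₗ_surjective a
      rw [← map_zero I.mkₗ, ← mkₗ_mul, mul_zero]
    mul_assoc := fun a b c => by
      obtain ⟨a, rfl⟩ := I.mkₗ_surjective a
      obtain ⟨b, rfl⟩ := I.mkₗ_surjective b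
      obtain ⟨c, rfl⟩ := I.mkₗ_surjective c
      rw [← mkₗ_mul, ← mkₗ_mul, ← mkₗ_mul, ← mkₗ_mul, mul_assoc] }

instance : StarRing I.Quotient where
  star_involutive a := by
    obtain ⟨a, rfl⟩ := I.mkₗ_surjective a
    rw [← mkₗ_star, ← mkₗ_star, star_star]
  star_mul a b := by
    obtain ⟨a, rfl⟩ := I.mkₗ_surjective a
    obtain ⟨b, rfl⟩ := I.mkₗ_surjective b
    rw [← mkₗ_mul, ← mkₗ_star, ← mkₗ_star, ← mkₗ_star, ← mkₗ_mul, star_mul]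
  star_add a b := by
    obtain ⟨a, rfl⟩ := I.mkₗ_surjective a
    obtain ⟨b, rfl⟩ := I.mkₗ_surjective b
    rw [← map_add, ← mkₗ_star, ← mkₗ_star, ← mkₗ_star, ← map_add, star_add]

instance [StarModule ℂ B] : StarModule ℂ I.Quotient where
  star_smul c a := by
    obtain ⟨a, rfl⟩ := I.mkₗ_surjective a
    rw [← map_smul, ← mkₗ_star, ← mkₗ_star, ← map_smul, star_smul]

instance [IsScalarTower ℂ B B] : IsScalarTower ℂ I.Quotient I.Quotient where
  smul_assoc c a b := by
    obtain ⟨a, rfl⟩ := I.mkₗ_surjective a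
    obtain ⟨b, rfl⟩ := I.mkₗ_surjective b
    rw [smul_eq_mul, smul_eq_mul, ← map_smul, ← mkₗ_mul, ← mkₗ_mul, ← map_smul, smul_mul_assoc]

instance [SMulCommClass ℂ B B] : SMulCommClass ℂ I.Quotient I.Quotient where
  smul_comm c a b := by
    obtain ⟨a, rfl⟩ := I.mkₗ_surjective a
    obtain ⟨b, rfl⟩ := I.mkₗ_surjective b
    rw [smul_eq_mul, smul_eq_mul, ← map_smul, ← mkₗ_mul, ← mkₗ_mul, ← map_smul, mul_smul_comm]

/-- The quotient map `B → B / I` as a `*`-homomorphism. -/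
def quotHom : B →⋆ₙₐ[ℂ] I.Quotient :=
  { I.mkₗ with
    map_zero' := map_zero I.mkₗ
    map_mul' := fun _ _ => rfl
    map_star' := fun _ => rfl }

theorem quotHom_surjective : Function.Surjective I.quotHom := I.mkₗ_surjective

theorem quotHom_eq_zero_iff {x : B} : I.quotHom x = 0 ↔ x ∈ I.toSubmodule :=
  Submodule.Quotient.mk_eq_zero _

/-- The `*`-homomorphism between quotients induced by a `*`-homomorphism that maps `I` to `J`. -/
def map {C : Type u} [NonUnitalRing C] [StarRing C] [Module ℂ C] (I : StarIdeal B)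
    (J : StarIdeal C) (f : B →⋆ₙₐ[ℂ] C) (h : ∀ x ∈ I.toSubmodule, f x ∈ J.toSubmodule) :
    I.Quotient →⋆ₙₐ[ℂ] J.Quotient :=
  { Submodule.mapQ I.toSubmodule J.toSubmodule ((f : B →ₙₐ[ℂ] C) : B →ₗ[ℂ] C) h with
    map_zero' := map_zero (Submodule.mapQ I.toSubmodule J.toSubmodule
      ((f : B →ₙₐ[ℂ] C) : B →ₗ[ℂ] C) h)
    map_mul' := fun a b => by
      obtain ⟨a, rfl⟩ := I.mkₗ_surjective a
      obtain ⟨b, rfl⟩ := I.mkₗ_surjective b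
      exact congrArg J.mkₗ (map_mul f a b)
    map_star' := fun a => by
      obtain ⟨a, rfl⟩ := I.mkₗ_surjective a
      exact congrArg J.mkₗ (map_star f a) }

theorem map_quotHom {C : Type u} [NonUnitalRing C] [StarRing C] [Module ℂ C] (I : StarIdeal B)
    (J : StarIdeal C) (f : B →⋆ₙₐ[ℂ] C) (h : ∀ x ∈ I.toSubmodule, f x ∈ J.toSubmodule) (b : B) :
    map I J f h (I.quotHom b) = J.quotHom (f b) := rfl

end StarIdeal

/-! ### Sequence algebras and the Rokhlin property -/

section SequenceAlgebra

variable (A : Type u) [NonUnitalCStarAlgebra A]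

/-- The ideal `c₀(ℕ, A)` of `ℓ^∞(ℕ, A)`; the latter is `ℕ →ᵇ A`, all bounded sequences in `A` with
the supremum norm and pointwise operations. -/
def c₀Ideal : StarIdeal (ℕ →ᵇ A) where
  carrier := {a | Tendsto (fun n => ‖a n‖) atTop (𝓝 0)}
  add_mem' {a b} ha hb := by
    refine squeeze_zero (fun n => norm_nonneg _) (fun n => norm_add_le (a n) (b n)) ?_
    simpa using ha.add hb
  zero_mem' := by simp
  smul_mem' c a ha := by
    refine squeeze_zero (fun n => norm_nonneg _) (fun n => norm_smul_le c (a n)) ?_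
    simpa using ha.const_mul ‖c‖
  mul_left_mem b a ha := by
    refine squeeze_zero (fun n => norm_nonneg _) (fun n => (norm_mul_le (b n) (a n)).trans
      (mul_le_mul_of_nonneg_right (b.norm_coe_le_norm n) (norm_nonneg _))) ?_
    simpa using Tendsto.const_mul ‖b‖ ha
  mul_right_mem b a ha := by
    refine squeeze_zero (fun n => norm_nonneg _) (fun n => (norm_mul_le (a n) (b n)).trans
      (mul_le_mul_of_nonneg_left (b.norm_coe_le_norm n) (norm_nonneg _))) ?_
    simpa using Tendsto.mul_const ‖b‖ ha
  star_mem a ha := by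
    simpa [norm_star] using ha

/-- The sequence algebra `A_∞ = ℓ^∞(ℕ, A) / c₀(ℕ, A)`. -/
abbrev SeqAlg : Type u := (c₀Ideal A).Quotient

/-- The quotient map `η_A : ℓ^∞(ℕ, A) → A_∞`. -/
def etaSeq : (ℕ →ᵇ A) →⋆ₙₐ[ℂ] SeqAlg A := (c₀Ideal A).quotHom

variable {A}

/-- The embedding of `A` in `A_∞` by constant sequences. -/
def constSeq (a : A) : SeqAlg A := etaSeq A (BoundedContinuousFunction.const ℕ a)

theorem constSeq_star (a : A) : constSeq (star a) = star (constSeq a) := by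
  rw [constSeq, constSeq, ← map_star]
  congr 1

/-- The relative commutant `A_∞ ∩ D'`. -/
def relCommutant (D : NonUnitalStarSubalgebra ℂ A) : NonUnitalStarSubalgebra ℂ (SeqAlg A) where
  carrier := {x | ∀ d ∈ D, x * constSeq d = constSeq d * x}
  add_mem' {x y} hx hy d hd := by rw [add_mul, mul_add, hx d hd, hy d hd]
  zero_mem' d _ := by rw [zero_mul, mul_zero]
  mul_mem' {x y} hx hy d hd := by rw [mul_assoc, hy d hd, ← mul_assoc, hx d hd, mul_assoc]
  smul_mem' c x hx d hd := by rw [smul_mul_assoc, hx d hd, mul_smul_comm]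
  star_mem' {x} hx d hd := by
    have h := congrArg star (hx (star d) (star_mem hd))
    rw [star_mul, star_mul] at h
    rw [← constSeq_star, star_star] at h
    exact h.symm

/-- The annihilator `Ann(D, A_∞)`, as an ideal of `A_∞ ∩ D'`. -/
def annIdeal (D : NonUnitalStarSubalgebra ℂ A) : StarIdeal (relCommutant D) where
  carrier := {x | ∀ d ∈ D, (x : SeqAlg A) * constSeq d = 0 ∧ constSeq d * (x : SeqAlg A) = 0}
  add_mem' {x y} hx hy d hd := by
    simp [add_mul, mul_add, hx d hd, hy d hd]
  zero_mem' d _ := by simp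
  smul_mem' c x hx d hd := by
    simp [smul_mul_assoc, mul_smul_comm, hx d hd]
  mul_left_mem b x hx d hd := by
    refine ⟨?_, ?_⟩
    · rw [NonUnitalStarSubalgebra.coe_mul, mul_assoc, (hx d hd).1, mul_zero]
    · rw [NonUnitalStarSubalgebra.coe_mul, ← mul_assoc, ← b.2 d hd, mul_assoc, (hx d hd).2,
        mul_zero]
  mul_right_mem b x hx d hd := by
    refine ⟨?_, ?_⟩
    · rw [NonUnitalStarSubalgebra.coe_mul, mul_assoc, b.2 d hd, ← mul_assoc, (hx d hd).1, zero_mul]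
    · rw [NonUnitalStarSubalgebra.coe_mul, ← mul_assoc, (hx d hd).2, zero_mul]
  star_mem x hx d hd := by
    have h := hx (star d) (star_mem hd)
    refine ⟨?_, ?_⟩
    · rw [← star_star (constSeq d), ← constSeq_star, StarMemClass.coe_star, ← star_mul,
        h.2, star_zero]
    · rw [← star_star (constSeq d), ← constSeq_star, StarMemClass.coe_star, ← star_mul,
        h.1, star_zero]

/-- Kirchberg's algebra `F(D, A) = (A_∞ ∩ D') / Ann(D, A_∞)`. -/
abbrev FAlg (D : NonUnitalStarSubalgebra ℂ A) : Type u := (annIdeal D).Quotient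

/-- The quotient map `κ_{D, A} : A_∞ ∩ D' → F(D, A)`. -/
def kappa (D : NonUnitalStarSubalgebra ℂ A) : relCommutant D →⋆ₙₐ[ℂ] FAlg D :=
  (annIdeal D).quotHom

end SequenceAlgebra

namespace CStarAction

variable {G : Type v} {A : Type u} [Group G] [TopologicalSpace G] [NonUnitalCStarAlgebra A]
variable (α : CStarAction G A)

/-- The action `α^∞` on `ℓ^∞(ℕ, A)`, given by applying `α` to every term of a sequence. -/
def linfAct (g : G) : (ℕ →ᵇ A) →⋆ₙₐ[ℂ] (ℕ →ᵇ A) where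
  toFun a := BoundedContinuousFunction.ofNormedAddCommGroup (fun n => α g (a n))
    continuous_of_discreteTopology ‖a‖ (fun n => by
      rw [α.norm_apply]; exact a.norm_coe_le_norm n)
  map_smul' c a := by ext n; exact map_smul (α g) c (a n)
  map_zero' := by ext n; exact map_zero (α g)
  map_add' a b := by ext n; exact map_add (α g) (a n) (b n)
  map_mul' a b := by ext n; exact map_mul (α g) (a n) (b n)
  map_star' a := by ext n; exact map_star (α g) (a n)

theorem linfAct_apply (g : G) (a : ℕ →ᵇ A) (n : ℕ) : α.linfAct g a n = α g (a n) := rfl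

theorem linfAct_mul (g h : G) (a : ℕ →ᵇ A) :
    α.linfAct (g * h) a = α.linfAct g (α.linfAct h a) := by
  ext n; exact α.mul_apply g h (a n)

/-- The action `α_∞` on `A_∞`. -/
def seqAct (g : G) : SeqAlg A →⋆ₙₐ[ℂ] SeqAlg A :=
  StarIdeal.map (c₀Ideal A) (c₀Ideal A) (α.linfAct g) (fun x hx => by
    change Tendsto (fun n => ‖α g (x n)‖) atTop (𝓝 0)
    simp only [α.norm_apply]
    exact hx)

theorem seqAct_eta (g : G) (a : ℕ →ᵇ A) :
    α.seqAct g (etaSeq A a) = etaSeq A (α.linfAct g a) := rfl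

theorem seqAct_constSeq (g : G) (a : A) : α.seqAct g (constSeq a) = constSeq (α g a) := rfl

/-- `ℓ^∞_α(ℕ, A)`: the bounded sequences whose orbit map under `α^∞` is continuous for the
supremum norm. -/
def linfCont : NonUnitalStarSubalgebra ℂ (ℕ →ᵇ A) where
  carrier := {a | Continuous fun g => α.linfAct g a}
  add_mem' {a b} ha hb := by
    simp only [Set.mem_ofPred_eq, map_add] at *
    exact ha.add hb
  zero_mem' := by
    simp only [Set.mem_ofPred_eq, map_zero]
    exact continuous_const
  mul_mem' {a b} ha hb := by
    simp only [Set.mem_ofPred_eq, map_mul] at *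
    exact ha.mul hb
  smul_mem' c a ha := by
    simp only [Set.mem_ofPred_eq, map_smul] at *
    exact ha.const_smul c
  star_mem' {a} ha := by
    simp only [Set.mem_ofPred_eq, map_star] at *
    exact ha.star

/-- `A_{∞, α} = η_A(ℓ^∞_α(ℕ, A))`. -/
def seqCont : NonUnitalStarSubalgebra ℂ (SeqAlg A) := α.linfCont.map (etaSeq A)

variable (D : NonUnitalStarSubalgebra ℂ A)

theorem seqAct_mem_relCommutant (hD : α.IsInvariant D) (g : G) {x : SeqAlg A} (hx : x ∈ relCommutant D) :
    α.seqAct g x ∈ relCommutant D := by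
  intro d hd
  have h := congrArg (α.seqAct g) (hx (α g⁻¹ d) (hD _ _ hd))
  have h1 : α g (α g⁻¹ d) = d := by rw [← α.mul_apply, mul_inv_cancel, α.one_apply]
  rwa [map_mul, map_mul, seqAct_constSeq, h1] at h

/-- The action `α_∞` on `A_∞ ∩ D'`, for an invariant subalgebra `D`. -/
def relCommutantAct (hD : α.IsInvariant D) (g : G) : relCommutant D →⋆ₙₐ[ℂ] relCommutant D :=
  NonUnitalStarAlgHom.codRestrict
    ((α.seqAct g).comp (NonUnitalStarSubalgebraClass.subtype (relCommutant D))) (relCommutant D)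
    (fun x => α.seqAct_mem_relCommutant D hD g x.2)

/-- The action `F(α)` on `F(D, A)`, for an invariant subalgebra `D`. -/
def fAct (hD : α.IsInvariant D) (g : G) : FAlg D →⋆ₙₐ[ℂ] FAlg D :=
  StarIdeal.map (annIdeal D) (annIdeal D) (α.relCommutantAct D hD g) (fun x hx d hd => by
    have h := hx (α g⁻¹ d) (hD _ _ hd)
    have h1 : α g (α g⁻¹ d) = d := by rw [← α.mul_apply, mul_inv_cancel, α.one_apply]
    refine ⟨?_, ?_⟩
    · have h2 := congrArg (α.seqAct g) h.1
      rwa [map_mul, seqAct_constSeq, h1, map_zero] at h2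
    · have h2 := congrArg (α.seqAct g) h.2
      rwa [map_mul, seqAct_constSeq, h1, map_zero] at h2)

/-- `F_α(D, A) = κ_{D, A}(A_{∞, α} ∩ D')`, as a subalgebra of `F(D, A)`. -/
def fCont : NonUnitalStarSubalgebra ℂ (FAlg D) :=
  (α.seqCont.comap (NonUnitalStarSubalgebraClass.subtype (relCommutant D))).map (kappa D)

/-- Left translation `Lt_g` on `C(G)`: `Lt_g(f)(h) = f(g⁻¹ h)`. -/
def leftTranslate [IsTopologicalGroup G] (g : G) (f : C(G, ℂ)) : C(G, ℂ) :=
  f.comp ⟨fun h => g⁻¹ * h, continuous_const_mul g⁻¹⟩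

/-- The Rokhlin property: for every separable `α`-invariant `C^*`-subalgebra `D` of `A` there is a
unital equivariant `*`-homomorphism `(C(G), Lt) → (F_α(D, A), F(α))`. -/
def HasRokhlinProperty [IsTopologicalGroup G] [CompactSpace G] : Prop :=
  ∀ (D : NonUnitalStarSubalgebra ℂ A) (hD : α.IsInvariant D),
    IsClosed (D : Set A) → TopologicalSpace.IsSeparable (D : Set A) →
    ∃ φ : C(G, ℂ) →⋆ₙₐ[ℂ] α.fCont D,
      (∀ x : α.fCont D, φ 1 * x = x ∧ x * φ 1 = x) ∧
      ∀ (g : G) (f : C(G, ℂ)),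
        (φ (leftTranslate g f) : FAlg D) = α.fAct D hD g (φ f : FAlg D)

end CStarAction

/-! ### Crossed products -/

section CrossedProduct

set_option linter.unusedSectionVars false

variable {G : Type v} {A : Type u} [Group G] [TopologicalSpace G] [IsTopologicalGroup G]
  [CompactSpace G] [SecondCountableTopology G] [MeasurableSpace G] [BorelSpace G]
  [NonUnitalCStarAlgebra A]

variable (G) in
/-- The normalized Haar measure of the compact group `G`. -/
def normHaar : Measure G := Measure.haarMeasure ⊤

instance : IsProbabilityMeasure (normHaar G) :=
  ⟨by simpa [normHaar] using Measure.haarMeasure_self (K₀ := (⊤ : TopologicalSpace.PositiveCompacts G))⟩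

instance : (normHaar G).IsMulLeftInvariant :=
  inferInstanceAs (Measure.haarMeasure ⊤).IsMulLeftInvariant

theorem integrable_normHaar {E : Type*} [NormedAddCommGroup E] {f : G → E}
    (hf : Continuous f) : Integrable f (normHaar G) :=
  hf.integrable_of_hasCompactSupport (HasCompactSupport.of_compactSpace f)

theorem integral_swap_normHaar {E : Type*} [NormedAddCommGroup E] [NormedSpace ℝ E]
    {f : G → G → E} (hf : Continuous (Function.uncurry f)) :
    ∫ x, ∫ y, f x y ∂normHaar G ∂normHaar G = ∫ y, ∫ x, f x y ∂normHaar G ∂normHaar G :=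
  integral_integral_swap_of_hasCompactSupport hf (HasCompactSupport.of_compactSpace _)

theorem continuous_integral_normHaar {E : Type*} [NormedAddCommGroup E] [NormedSpace ℝ E]
    {f : G → G → E} (hf : Continuous (Function.uncurry f)) :
    Continuous fun x => ∫ y, f x y ∂normHaar G := by
  simpa using continuous_parametric_integral_of_continuous (μ := normHaar G) hf isCompact_univ

/-- The `*`-algebra `C(G, A)` of continuous functions with the twisted convolution
`(f * h)(g) = ∫ f(s) α_s(h(s⁻¹ g)) ds` and the involution `f^*(g) = α_g(f(g⁻¹)^*)`
(compact groups are unimodular). -/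
def ConvAlg (_α : CStarAction G A) : Type (max u v) := C(G, A)

namespace ConvAlg

variable {α : CStarAction G A}

instance : AddCommGroup (ConvAlg α) := inferInstanceAs (AddCommGroup C(G, A))
instance : Module ℂ (ConvAlg α) := inferInstanceAs (Module ℂ C(G, A))
instance : FunLike (ConvAlg α) G A := inferInstanceAs (FunLike C(G, A) G A)
instance : ContinuousMapClass (ConvAlg α) G A := inferInstanceAs (ContinuousMapClass C(G, A) G A)

theorem cont (f : ConvAlg α) : Continuous f := map_continuous f

@[fun_prop]
theorem cont_comp {X : Type*} [TopologicalSpace X] (f : ConvAlg α) {k : X → G}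
    (hk : Continuous k) : Continuous fun x => f (k x) := f.cont.comp hk

theorem cont_act {X : Type*} [TopologicalSpace X] (α : CStarAction G A) {k : X → G} {a : X → A}
    (hk : Continuous k) (ha : Continuous a) : Continuous fun x => α (k x) (a x) :=
  α.continuous_uncurry.comp (hk.prodMk ha)

@[ext] theorem ext {f h : ConvAlg α} (H : ∀ g, f g = h g) : f = h := DFunLike.ext _ _ H

@[simp] theorem add_apply (f h : ConvAlg α) (g : G) : (f + h) g = f g + h g := rfl
@[simp] theorem zero_apply (g : G) : (0 : ConvAlg α) g = 0 := rfl
@[simp] theorem smul_apply (c : ℂ) (f : ConvAlg α) (g : G) : (c • f) g = c • f g := rfl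

theorem cont_integrand (f h : ConvAlg α) :
    Continuous (Function.uncurry fun g s : G => f s * α s (h (s⁻¹ * g))) := by
  refine Continuous.mul (by fun_prop) (cont_act α (by fun_prop) (by fun_prop))

theorem cont_integrand' (f h : ConvAlg α) (g : G) :
    Continuous fun s : G => f s * α s (h (s⁻¹ * g)) := by
  refine Continuous.mul (by fun_prop) (cont_act α (by fun_prop) (by fun_prop))

instance : Mul (ConvAlg α) where
  mul f h := (⟨fun g => ∫ s, f s * α s (h (s⁻¹ * g)) ∂normHaar G,
    continuous_integral_normHaar (cont_integrand f h)⟩ : C(G, A))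

theorem mul_apply (f h : ConvAlg α) (g : G) :
    (f * h) g = ∫ s, f s * α s (h (s⁻¹ * g)) ∂normHaar G := rfl

instance : Star (ConvAlg α) where
  star f := (⟨fun g => α g (star (f g⁻¹)),
    cont_act α continuous_id (by fun_prop)⟩ : C(G, A))

theorem star_apply (f : ConvAlg α) (g : G) : (star f) g = α g (star (f g⁻¹)) := rfl

theorem integral_mul_left (a : A) {φ : G → A} (hφ : Continuous φ) :
    ∫ s, a * φ s ∂normHaar G = a * ∫ s, φ s ∂normHaar G :=
  (ContinuousLinearMap.mul ℂ A a).integral_comp_comm (integrable_normHaar hφ)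

theorem integral_mul_right (a : A) {φ : G → A} (hφ : Continuous φ) :
    ∫ s, φ s * a ∂normHaar G = (∫ s, φ s ∂normHaar G) * a :=
  ((ContinuousLinearMap.mul ℂ A).flip a).integral_comp_comm (integrable_normHaar hφ)

theorem integral_act (α : CStarAction G A) (g : G) {φ : G → A} (hφ : Continuous φ) :
    ∫ s, α g (φ s) ∂normHaar G = α g (∫ s, φ s ∂normHaar G) :=
  (⟨⟨⟨α g, map_add (α g)⟩, map_smul (α g)⟩, (α.isometry_apply g).continuous⟩ :
    A →L[ℂ] A).integral_comp_comm (integrable_normHaar hφ)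

theorem integral_star' (φ : G → A) :
    ∫ s, star (φ s) ∂normHaar G = star (∫ s, φ s ∂normHaar G) :=
  (starL' ℝ : A ≃L[ℝ] A).integral_comp_comm φ

protected theorem mul_assoc' (f h k : ConvAlg α) : f * h * k = f * (h * k) := by
  ext g
  have h1 : (f * h * k) g = ∫ s, ∫ t, f t * α t (h (t⁻¹ * s)) * α s (k (s⁻¹ * g))
      ∂normHaar G ∂normHaar G := by
    rw [mul_apply]
    refine integral_congr_ae (.of_forall fun s => ?_)
    exact (integral_mul_right _ (cont_integrand' f h s)).symm
  have h2 : (f * (h * k)) g = ∫ t, ∫ s, f t * α t (h (t⁻¹ * s)) * α s (k (s⁻¹ * g))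
      ∂normHaar G ∂normHaar G := by
    rw [mul_apply]
    refine integral_congr_ae (.of_forall fun t => ?_)
    change f t * α t ((h * k) (t⁻¹ * g)) = _
    rw [mul_apply, ← integral_act α t (cont_integrand' h k _), ← integral_mul_left]
    · rw [← integral_mul_left_eq_self _ t⁻¹]
      refine integral_congr_ae (.of_forall fun s => ?_)
      change f t * α t (h (t⁻¹ * s) * α (t⁻¹ * s) (k ((t⁻¹ * s)⁻¹ * (t⁻¹ * g)))) = _
      have e1 : t * (t⁻¹ * s) = s := by group
      have e2 : (t⁻¹ * s)⁻¹ * (t⁻¹ * g) = s⁻¹ * g := by group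
      rw [map_mul, ← α.mul_apply, e1, e2, ← mul_assoc]
    · exact cont_act α continuous_const (cont_integrand' h k _)
  rw [h1, h2]
  refine integral_swap_normHaar (f := fun s t => f t * α t (h (t⁻¹ * s)) * α s (k (s⁻¹ * g))) ?_
  exact (Continuous.mul (by fun_prop) (cont_act α (by fun_prop) (by fun_prop))).mul
    (cont_act α (by fun_prop) (by fun_prop))

instance : NonUnitalRing (ConvAlg α) :=
  { (inferInstance : AddCommGroup (ConvAlg α)), (inferInstance : Mul (ConvAlg α)) with
    left_distrib := fun f h k => by
      ext g
      simp only [mul_apply, add_apply, map_add, mul_add]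
      exact integral_add (integrable_normHaar (cont_integrand' f h g))
        (integrable_normHaar (cont_integrand' f k g))
    right_distrib := fun f h k => by
      ext g
      simp only [mul_apply, add_apply, add_mul]
      exact integral_add (integrable_normHaar (cont_integrand' f k g))
        (integrable_normHaar (cont_integrand' h k g))
    zero_mul := fun f => by ext g; simp [mul_apply]
    mul_zero := fun f => by ext g; simp [mul_apply]
    mul_assoc := ConvAlg.mul_assoc' }

instance : StarRing (ConvAlg α) where
  star_involutive f := by
    ext g
    rw [star_apply, star_apply, ← map_star (α g⁻¹), star_star, inv_inv,
      ← α.mul_apply, mul_inv_cancel, α.one_apply]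
  star_add f h := by
    ext g
    simp [star_apply]
  star_mul f h := by
    ext g
    rw [star_apply, mul_apply, mul_apply, ← integral_star', ← integral_act,
      ← integral_mul_left_eq_self (fun s => (star h) s * α s ((star f) (s⁻¹ * g))) g]
    · refine integral_congr_ae (.of_forall fun s => ?_)
      change α g (star (f s * α s (h (s⁻¹ * g⁻¹)))) =
        (star h) (g * s) * α (g * s) ((star f) ((g * s)⁻¹ * g))
      have e1 : (g * s)⁻¹ = s⁻¹ * g⁻¹ := by group
      have e2 : g * s * (s⁻¹ * g⁻¹ * g) = g := by group
      have e3 : (s⁻¹ * g⁻¹ * g)⁻¹ = s := by group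
      rw [star_mul, map_mul, star_apply, star_apply, ← map_star (α s), ← α.mul_apply,
        ← α.mul_apply, e1, e2, e3]
    · exact (cont_integrand' f h _).star

instance : StarModule ℂ (ConvAlg α) where
  star_smul c f := by ext g; simp [star_apply]

instance : IsScalarTower ℂ (ConvAlg α) (ConvAlg α) where
  smul_assoc c f h := by
    ext g
    simp only [smul_eq_mul, mul_apply, smul_apply, smul_mul_assoc]
    exact integral_smul c _

instance : SMulCommClass ℂ (ConvAlg α) (ConvAlg α) where
  smul_comm c f h := by
    ext g
    simp only [smul_eq_mul, mul_apply, smul_apply, map_smul, mul_smul_comm]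
    exact (integral_smul c _).symm

variable (α) in
/-- The `L¹`-norm on `C(G, A)`. -/
def l1Seminorm : Seminorm ℂ (ConvAlg α) :=
  Seminorm.of (fun f => ∫ g, ‖f g‖ ∂normHaar G)
    (fun f h => by
      rw [← integral_add (integrable_normHaar f.cont.norm) (integrable_normHaar h.cont.norm)]
      exact integral_mono (integrable_normHaar (f + h).cont.norm)
        ((integrable_normHaar f.cont.norm).add (integrable_normHaar h.cont.norm))
        (fun g => norm_add_le (f g) (h g)))
    (fun c f => by
      simp only [smul_apply, norm_smul]
      exact integral_const_mul _ _)

theorem l1Seminorm_apply (f : ConvAlg α) : l1Seminorm α f = ∫ g, ‖f g‖ ∂normHaar G := rfl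

/-- `p` is a `C^*`-seminorm on the convolution algebra that is dominated by the `L¹`-norm.  These
are exactly the seminorms `f ↦ ‖π(f)‖` for the `*`-representations `π` of `L¹(G, A, α)` on Hilbert
spaces. -/
structure IsCStarSeminorm (p : Seminorm ℂ (ConvAlg α)) : Prop where
  mul_le : ∀ f h : ConvAlg α, p (f * h) ≤ p f * p h
  star_mul_self : ∀ f : ConvAlg α, p (star f * f) = p f ^ 2
  le_l1 : ∀ f : ConvAlg α, p f ≤ l1Seminorm α f

variable (α) in
/-- The universal norm of the (full) crossed product: the largest `C^*`-seminorm on `C(G, A)`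
dominated by the `L¹`-norm. -/
def univSeminorm : Seminorm ℂ (ConvAlg α) :=
  sSup {p : Seminorm ℂ (ConvAlg α) | IsCStarSeminorm p}

theorem isCStarSeminorm_zero : IsCStarSeminorm (0 : Seminorm ℂ (ConvAlg α)) where
  mul_le f h := by simp
  star_mul_self f := by simp
  le_l1 f := apply_nonneg _ _

theorem bddAbove_cstar : BddAbove {p : Seminorm ℂ (ConvAlg α) | IsCStarSeminorm p} :=
  ⟨l1Seminorm α, fun _ hp f => hp.le_l1 f⟩

theorem nonempty_cstar : {p : Seminorm ℂ (ConvAlg α) | IsCStarSeminorm p}.Nonempty :=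
  ⟨0, isCStarSeminorm_zero⟩

theorem le_univSeminorm {p : Seminorm ℂ (ConvAlg α)} (hp : IsCStarSeminorm p) (f : ConvAlg α) :
    p f ≤ univSeminorm α f :=
  le_csSup bddAbove_cstar hp f

theorem univSeminorm_le {f : ConvAlg α} {c : ℝ}
    (h : ∀ p : Seminorm ℂ (ConvAlg α), IsCStarSeminorm p → p f ≤ c) : univSeminorm α f ≤ c := by
  rw [univSeminorm, Seminorm.sSup_apply bddAbove_cstar]
  have : Nonempty {p : Seminorm ℂ (ConvAlg α) | IsCStarSeminorm p} := nonempty_cstar.to_subtype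
  exact ciSup_le fun p => h p.1 p.2

theorem isCStarSeminorm_univ : IsCStarSeminorm (univSeminorm α) where
  mul_le f h := univSeminorm_le fun p hp => (hp.mul_le f h).trans
    (mul_le_mul (le_univSeminorm hp f) (le_univSeminorm hp h) (apply_nonneg _ _)
      (apply_nonneg _ _))
  star_mul_self f := by
    refine le_antisymm (univSeminorm_le fun p hp => ?_) ?_
    · rw [hp.star_mul_self]
      exact pow_le_pow_left₀ (apply_nonneg _ _) (le_univSeminorm hp f) 2
    · refine Real.le_sqrt (apply_nonneg _ _) (apply_nonneg _ _) |>.1 (univSeminorm_le fun p hp => ?_)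
      refine Real.le_sqrt (apply_nonneg _ _) (apply_nonneg _ _) |>.2 ?_
      rw [← hp.star_mul_self]
      exact le_univSeminorm hp _
  le_l1 f := univSeminorm_le fun p hp => hp.le_l1 f

instance : SeminormedAddCommGroup (ConvAlg α) :=
  { AddGroupSeminorm.toSeminormedAddCommGroup (univSeminorm α).toAddGroupSeminorm with
    toAddCommGroup := inferInstance }

theorem norm_def (f : ConvAlg α) : ‖f‖ = univSeminorm α f := rfl

instance : NormedSpace ℂ (ConvAlg α) where
  norm_smul_le c f := (map_smul_eq_mul (univSeminorm α) c f).le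

instance : NonUnitalSeminormedRing (ConvAlg α) :=
  { (inferInstance : SeminormedAddCommGroup (ConvAlg α)),
    (inferInstance : NonUnitalRing (ConvAlg α)) with
    norm_mul_le := isCStarSeminorm_univ.mul_le }

theorem norm_star_mul_self (f : ConvAlg α) : ‖star f * f‖ = ‖f‖ * ‖f‖ := by
  rw [norm_def, isCStarSeminorm_univ.star_mul_self, sq, norm_def]

theorem norm_le_norm_star (f : ConvAlg α) : ‖f‖ ≤ ‖star f‖ := by
  rcases (norm_nonneg f).eq_or_lt with h0 | h0
  · rw [← h0]; exact norm_nonneg _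
  · refine le_of_mul_le_mul_right ?_ h0
    rw [← norm_star_mul_self]
    exact norm_mul_le _ _

instance : NormedStarGroup (ConvAlg α) where
  norm_star_le f := by
    simpa using norm_le_norm_star (star f)

end ConvAlg

/-- The crossed product `A ⋊_α G`: the completion of `C(G, A)` in the universal `C^*`-norm, that is,
the enveloping `C^*`-algebra of `L¹(G, A, α)`. -/
def CrossedProduct (α : CStarAction G A) : Type (max u v) := Completion (ConvAlg α)

namespace CrossedProduct

variable {α : CStarAction G A}

instance : NormedAddCommGroup (CrossedProduct α) :=
  inferInstanceAs (NormedAddCommGroup (Completion (ConvAlg α)))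
instance : NormedSpace ℂ (CrossedProduct α) :=
  inferInstanceAs (NormedSpace ℂ (Completion (ConvAlg α)))
instance : CompleteSpace (CrossedProduct α) :=
  inferInstanceAs (CompleteSpace (Completion (ConvAlg α)))

/-- The canonical map `C(G, A) → A ⋊_α G`. -/
def ofConv : ConvAlg α →ₗᵢ[ℂ] CrossedProduct α := Completion.toComplₗᵢ

theorem isDenseInducing_ofConv : IsDenseInducing (ofConv : ConvAlg α → CrossedProduct α) :=
  Completion.isDenseInducing_coe

theorem denseRange_ofConv : DenseRange (ofConv : ConvAlg α → CrossedProduct α) :=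
  isDenseInducing_ofConv.dense

instance : Mul (CrossedProduct α) where
  mul := Function.curry ((isDenseInducing_ofConv.prodMap isDenseInducing_ofConv).extend
    fun p : ConvAlg α × ConvAlg α => ofConv (p.1 * p.2))

theorem ofConv_mul (f h : ConvAlg α) : ofConv (f * h) = ofConv f * ofConv h :=
  ((isDenseInducing_ofConv.prodMap isDenseInducing_ofConv).extend_eq
    (f := fun p : ConvAlg α × ConvAlg α => (ofConv (p.1 * p.2) : CrossedProduct α))
    (ofConv.continuous.comp continuous_mul) (f, h)).symm

instance : ContinuousMul (CrossedProduct α) where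
  continuous_mul := by
    let e : ConvAlg α →+ CrossedProduct α := (ofConv : ConvAlg α →ₗᵢ[ℂ] _).toLinearMap.toAddMonoidHom
    let m := (AddMonoidHom.mul : ConvAlg α →+ ConvAlg α →+ ConvAlg α).compr₂ e
    have : Continuous fun p : ConvAlg α × ConvAlg α => m p.1 p.2 :=
      ofConv.continuous.comp continuous_mul
    have di : IsDenseInducing e := isDenseInducing_ofConv
    exact (di.extend_Z_bilin di this :)

instance : Star (CrossedProduct α) where
  star := isDenseInducing_ofConv.extend fun f => ofConv (star f)

theorem ofConv_star (f : ConvAlg α) : ofConv (star f) = star (ofConv f) :=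
  (isDenseInducing_ofConv.extend_eq
    (f := fun f : ConvAlg α => (ofConv (star f) : CrossedProduct α))
    (ofConv.continuous.comp continuous_star) f).symm

instance : ContinuousStar (CrossedProduct α) where
  continuous_star := by
    have : UniformContinuous fun f : ConvAlg α => (ofConv (star f) : CrossedProduct α) :=
      ofConv.isometry.uniformContinuous.comp (isometry_iff_dist_eq.2 fun f h => by
        rw [dist_eq_norm, dist_eq_norm, ← star_sub, norm_star]).uniformContinuous
    exact uniformContinuous_uniformly_extend (ofConv.isometry.isUniformInducing)
      denseRange_ofConv this |>.continuous

@[elab_as_elim]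
theorem induction₁ {p : CrossedProduct α → Prop} (x : CrossedProduct α)
    (hp : IsClosed {x | p x}) (ih : ∀ f, p (ofConv f)) : p x :=
  denseRange_ofConv.induction_on x hp ih

@[elab_as_elim]
theorem induction₂ {p : CrossedProduct α → CrossedProduct α → Prop} (x y : CrossedProduct α)
    (hp : IsClosed {x : CrossedProduct α × CrossedProduct α | p x.1 x.2})
    (ih : ∀ f k, p (ofConv f) (ofConv k)) : p x y :=
  denseRange_ofConv.induction_on₂ hp ih x y

@[elab_as_elim]
theorem induction₃ {p : CrossedProduct α → CrossedProduct α → CrossedProduct α → Prop}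
    (x y z : CrossedProduct α)
    (hp : IsClosed {x : CrossedProduct α × CrossedProduct α × CrossedProduct α |
      p x.1 x.2.1 x.2.2})
    (ih : ∀ f k l, p (ofConv f) (ofConv k) (ofConv l)) : p x y z :=
  denseRange_ofConv.induction_on₃ hp ih x y z

instance : NonUnitalRing (CrossedProduct α) :=
  { (inferInstance : AddCommGroup (CrossedProduct α)),
    (inferInstance : Mul (CrossedProduct α)) with
    zero_mul := fun a => by
      induction a using induction₁ with
      | hp => exact isClosed_eq (by fun_prop) (by fun_prop)
      | ih a =>
        rw [← map_zero (ofConv : ConvAlg α →ₗᵢ[ℂ] _), ← ofConv_mul, zero_mul]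
    mul_zero := fun a => by
      induction a using induction₁ with
      | hp => exact isClosed_eq (by fun_prop) (by fun_prop)
      | ih a =>
        rw [← map_zero (ofConv : ConvAlg α →ₗᵢ[ℂ] _), ← ofConv_mul, mul_zero]
    mul_assoc := fun a b c => by
      induction a, b, c using induction₃ with
      | hp => exact isClosed_eq (by fun_prop) (by fun_prop)
      | ih a b c =>
        rw [← ofConv_mul, ← ofConv_mul, ← ofConv_mul, ← ofConv_mul, mul_assoc]
    left_distrib := fun a b c => by
      induction a, b, c using induction₃ with
      | hp => exact isClosed_eq (by fun_prop) (by fun_prop)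
      | ih a b c =>
        rw [← map_add, ← ofConv_mul, ← ofConv_mul, ← ofConv_mul, ← map_add, mul_add]
    right_distrib := fun a b c => by
      induction a, b, c using induction₃ with
      | hp => exact isClosed_eq (by fun_prop) (by fun_prop)
      | ih a b c =>
        rw [← map_add, ← ofConv_mul, ← ofConv_mul, ← ofConv_mul, ← map_add, add_mul] }

instance : StarRing (CrossedProduct α) where
  star_involutive := fun a => by
    induction a using induction₁ with
    | hp => exact isClosed_eq (by fun_prop) (by fun_prop)
    | ih a =>
      rw [← ofConv_star, ← ofConv_star, star_star]
  star_mul := fun a b => by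
    induction a, b using induction₂ with
    | hp => exact isClosed_eq (by fun_prop) (by fun_prop)
    | ih a b =>
      rw [← ofConv_mul, ← ofConv_star, ← ofConv_star, ← ofConv_star, ← ofConv_mul, star_mul]
  star_add := fun a b => by
    induction a, b using induction₂ with
    | hp => exact isClosed_eq (by fun_prop) (by fun_prop)
    | ih a b =>
      rw [← map_add, ← ofConv_star, ← ofConv_star, ← ofConv_star, ← map_add, star_add]

theorem cont_smul (c : ℂ) : Continuous fun x : CrossedProduct α => c • x :=
  continuous_const_smul c

theorem smul_mul_aux (c : ℂ) (a b : CrossedProduct α) : c • a * b = c • (a * b) := by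
  refine induction₂ (p := fun a b => c • a * b = c • (a * b)) a b ?_ fun a b => ?_
  · exact isClosed_eq (((cont_smul c).comp continuous_fst).mul continuous_snd)
      ((cont_smul c).comp (continuous_fst.mul continuous_snd))
  · rw [← map_smul, ← ofConv_mul, ← ofConv_mul, ← map_smul, smul_mul_assoc]

theorem mul_smul_aux (c : ℂ) (a b : CrossedProduct α) : a * c • b = c • (a * b) := by
  refine induction₂ (p := fun a b => a * c • b = c • (a * b)) a b ?_ fun a b => ?_
  · exact isClosed_eq (continuous_fst.mul ((cont_smul c).comp continuous_snd))
      ((cont_smul c).comp (continuous_fst.mul continuous_snd))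
  · rw [← map_smul, ← ofConv_mul, ← ofConv_mul, ← map_smul, mul_smul_comm]

instance : IsScalarTower ℂ (CrossedProduct α) (CrossedProduct α) where
  smul_assoc c a b := smul_mul_aux c a b

instance : SMulCommClass ℂ (CrossedProduct α) (CrossedProduct α) where
  smul_comm c a b := (mul_smul_aux c a b).symm

instance : StarModule ℂ (CrossedProduct α) where
  star_smul c a := by
    refine induction₁ (p := fun a => star (c • a) = star c • star a) a ?_ fun a => ?_
    · exact isClosed_eq (cont_smul c).star ((cont_smul (star c)).comp continuous_star)
    · rw [← map_smul, ← ofConv_star, ← ofConv_star, ← map_smul, star_smul]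

instance : NonUnitalNormedRing (CrossedProduct α) :=
  { (inferInstance : NormedAddCommGroup (CrossedProduct α)),
    (inferInstance : NonUnitalRing (CrossedProduct α)) with
    norm_mul_le := fun a b => by
      induction a, b using induction₂ with
      | hp => exact isClosed_le (by fun_prop) (by fun_prop)
      | ih a b =>
        rw [← ofConv_mul, LinearIsometry.norm_map, LinearIsometry.norm_map, LinearIsometry.norm_map]
        exact norm_mul_le a b }

instance : CStarRing (CrossedProduct α) where
  norm_mul_self_le := fun a => by
    induction a using induction₁ with
    | hp => exact isClosed_le (by fun_prop) (by fun_prop)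
    | ih a =>
      rw [← ofConv_star, ← ofConv_mul, LinearIsometry.norm_map, LinearIsometry.norm_map,
        ConvAlg.norm_star_mul_self]

/-- The crossed product is a `C^*`-algebra. -/
instance : NonUnitalCStarAlgebra (CrossedProduct α) where

variable (α) in
/-- For an invariant closed ideal `J` of `A`, the ideal `J ⋊_α G` of `A ⋊_α G`: the closure of (the
image of) the continuous functions on `G` with values in `J`. -/
def ofIdeal (J : TwoSidedIdeal A) : Set (CrossedProduct α) :=
  closure (ofConv '' {f : ConvAlg α | ∀ g, f g ∈ J})

end CrossedProduct

end CrossedProduct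

end

noncomputable section

/-! ### Averaging over compact groups -/

/-! The mechanism is a full corner. Write `cst c` for the constant function with value `c`. Since
`cst c * f * cst d` equals `cst (c * avg ((∫ f) * d))` for fixed `d`, the constants with values in
`A^α` behave like the corner `p (A ⋊ G) p` cut out by the projection "constant function 1" of the
multiplier algebra. The embedding `fixHom` of `A^α` is isometric because the regular representation,
realised through an `A`-valued inner product, bounds the universal norm from below (`norm_cst`).

The Rokhlin property makes this corner full, in a quantitative form
(`HasRokhlinProperty.exists_approx`): each function `g ↦ k(g) c` is a uniform limit of finite sums
of `g ↦ a c α_g(b)`. Indeed `k(g)`, as a constant function of `h`, is close to `∑ ρ_i(h) η_i(g⁻¹h)`.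
The equivariant map `φ` sends this to `∑ φ(ρ_i) F(α)_g(φ(η_i))`, and representing sequences
asymptotically commute with `c`, so `c` can be moved between the two factors.

For a closed ideal `I` of the crossed product take `J = {c | cst c ∈ I}` (`coeffIdeal`). Saturation
makes `J` a right ideal and puts every `J`-valued function in `I`. Conversely, an approximate unit
of the crossed product is approximated by sums `T = ∑ L_i * cst e * R_i`, and `T x T` for `x ∈ I`
then has its coefficients in the corner, hence in `J`. An ideal of `A^α` is first transported to the
crossed product by `cornerIdeal`, and its `coeffIdeal` intersects `A^α` in the original ideal.
Simplicity follows from the two correspondences. -/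

theorem exists_finite_approx {X : Type*} [TopologicalSpace X] [CompactSpace X] {E : Type*}
    [NormedAddCommGroup E] [NormedSpace ℂ E] {F : X → E} (hF : Continuous F) {ε : ℝ} (hε : 0 < ε) :
    ∃ (n : ℕ) (ρ : Fin n → C(X, ℂ)) (x : Fin n → X),
      ∀ y, ‖F y - ∑ i, ρ i y • F (x i)‖ ≤ ε := by
  obtain ⟨t, -, ht⟩ := isCompact_univ.elim_finite_subcover_image (b := Set.univ)
    (c := fun x : X => F ⁻¹' Metric.ball (F x) ε)
    (fun x _ => Metric.isOpen_ball.preimage hF)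
    (fun x _ => Set.mem_iUnion₂.2 ⟨x, trivial, Metric.mem_ball_self hε⟩)
  obtain ⟨htf, hcov⟩ := ht
  obtain ⟨n, x, hx⟩ : ∃ (n : ℕ) (x : Fin n → X), Set.range x = t := by
    have := htf.fintype
    exact ⟨_, fun i => ((Fintype.equivFin t).symm i : X), by
      rw [Set.range_comp' (f := (Fintype.equivFin t).symm) (g := Subtype.val)]; simp⟩
  -- The partition of unity is built from `F` itself: the `i`-th weight vanishes wherever `F y` is
  -- at distance at least `ε` from `F (x i)`. No separation axiom on `X` is needed.
  let w : Fin n → X → ℝ := fun i y => max 0 (ε - ‖F y - F (x i)‖)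
  have hw0 : ∀ i y, 0 ≤ w i y := fun i y => le_max_left _ _
  have hwc : ∀ i, Continuous (w i) := fun i => by fun_prop
  let S : X → ℝ := fun y => ∑ i, w i y
  have hSc : Continuous S := continuous_finsetSum _ fun i _ => hwc i
  have hS : ∀ y, 0 < S y := by
    intro y
    obtain ⟨z, hz, hyz⟩ := Set.mem_iUnion₂.1 (hcov (Set.mem_univ y))
    rw [← hx] at hz
    obtain ⟨i, rfl⟩ := hz
    refine Finset.sum_pos' (fun i _ => hw0 i y) ⟨i, Finset.mem_univ i, lt_max_of_lt_right ?_⟩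
    rw [Set.mem_preimage, Metric.mem_ball, dist_eq_norm] at hyz
    linarith
  refine ⟨n, fun i => ⟨fun y => ((w i y / S y : ℝ) : ℂ),
    Complex.continuous_ofReal.comp ((hwc i).div hSc fun y => (hS y).ne')⟩, x, fun y => ?_⟩
  have hsum : ∑ i, w i y / S y = 1 := by
    rw [← Finset.sum_div]; exact div_self (hS y).ne'
  have e : F y - ∑ i, ((w i y / S y : ℝ) : ℂ) • F (x i) =
      ∑ i, ((w i y / S y : ℝ) : ℂ) • (F y - F (x i)) := by
    simp only [smul_sub, Finset.sum_sub_distrib, ← Finset.sum_smul]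
    rw [← Complex.ofReal_sum, hsum, Complex.ofReal_one, one_smul]
  change ‖F y - ∑ i, ((w i y / S y : ℝ) : ℂ) • F (x i)‖ ≤ ε
  rw [e]
  calc _ ≤ ∑ i, w i y / S y * ε := by
        refine norm_sum_le_of_le _ fun i _ => ?_
        rw [norm_smul, Complex.norm_real, Real.norm_of_nonneg (div_nonneg (hw0 i y) (hS y).le)]
        rcases (hw0 i y).eq_or_lt with h | h
        · simp [← h]
        · refine mul_le_mul_of_nonneg_left ?_ (div_nonneg (hw0 i y) (hS y).le)
          by_contra hc
          have : w i y = 0 := max_eq_left (by linarith)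
          exact h.ne' this
    _ = ε := by rw [← Finset.sum_mul, hsum, one_mul]

/-- Currying: a jointly continuous `F` is a continuous map into `C(G, E)` with the supremum norm. -/
theorem eventually_norm_sub_le {G : Type*} [TopologicalSpace G] [CompactSpace G] {E : Type*}
    [NormedAddCommGroup E] {F : G → G → E}
    (hF : Continuous (Function.uncurry F)) (s₀ : G) {ε : ℝ} (hε : 0 < ε) :
    ∀ᶠ s in 𝓝 s₀, ∀ g, ‖F s g - F s₀ g‖ ≤ ε := by
  have h : Continuous fun s => (⟨F s, hF.comp (Continuous.prodMk_right s)⟩ : C(G, E)) :=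
    ContinuousMap.continuous_of_continuous_uncurry _ hF
  filter_upwards [(Metric.tendsto_nhds.1 (h.tendsto s₀)) ε hε] with s hs g
  rw [← dist_eq_norm]
  exact (ContinuousMap.dist_apply_le_dist g).trans hs.le

/-! ### Haar measure and symmetric approximate identities. -/

section Haar

variable {G : Type v} [Group G] [TopologicalSpace G] [IsTopologicalGroup G]
  [CompactSpace G] [MeasurableSpace G] [BorelSpace G]

instance : (normHaar G).IsHaarMeasure :=
  inferInstanceAs (Measure.haarMeasure ⊤).IsHaarMeasure

theorem norm_integral_normHaar_le {E : Type*} [NormedAddCommGroup E] [NormedSpace ℝ E] {f : G → E}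
    {C : ℝ} (h : ∀ g, ‖f g‖ ≤ C) : ‖∫ g, f g ∂normHaar G‖ ≤ C := by
  simpa using norm_integral_le_of_norm_le_const (μ := normHaar G) (.of_forall h)

variable [SecondCountableTopology G]

/-- A right translate of Haar measure is again a left-invariant probability measure, so uniqueness
applies. -/
instance : (normHaar G).IsMulRightInvariant where
  map_mul_right_eq_self g := by
    have : IsProbabilityMeasure (Measure.map (· * g) (normHaar G)) :=
      Measure.isProbabilityMeasure_map (measurable_mul_const g).aemeasurable
    exact Measure.isHaarMeasure_eq_of_isProbabilityMeasure _ _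

/-- A symmetric nonnegative function of integral one supported in a given neighbourhood of `1`. -/
theorem exists_bump [T2Space G] {U : Set G} (hU : U ∈ 𝓝 (1 : G)) :
    ∃ k : C(G, ℝ), (∀ s, 0 ≤ k s) ∧ ∫ s, k s ∂normHaar G = 1 ∧ (∀ s, k s ≠ 0 → s ∈ U) ∧
      ∀ s, k s⁻¹ = k s := by
  obtain ⟨V, hVU, hVo, hV1⟩ := mem_nhds_iff.1 hU
  obtain ⟨f, hf0, hf1, hf⟩ := exists_continuous_zero_one_of_isClosed (X := G) (s := Vᶜ) (t := {1})
    hVo.isClosed_compl isClosed_singleton (by simpa using hV1)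
  -- The product with the reflected function is symmetric, keeps its support condition from the
  -- first factor, and is still `1` at the identity.
  let h : C(G, ℝ) := ⟨fun s => f s * f s⁻¹, by fun_prop⟩
  have h0 : ∀ s, 0 ≤ h s := fun s => mul_nonneg (hf s).1 (hf s⁻¹).1
  have h1 : h 1 ≠ 0 := by
    have : f 1 = 1 := hf1 rfl
    simp [h, this]
  have hpos : 0 < ∫ s, h s ∂normHaar G :=
    h.continuous.integral_pos_of_hasCompactSupport_nonneg_nonzero
      (HasCompactSupport.of_compactSpace _) h0 h1
  refine ⟨(∫ s, h s ∂normHaar G)⁻¹ • h, fun s => ?_, ?_, fun s hs => ?_, fun s => ?_⟩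
  · exact mul_nonneg (inv_nonneg.2 hpos.le) (h0 s)
  · change ∫ s, (∫ s, h s ∂normHaar G)⁻¹ * h s ∂normHaar G = 1
    rw [integral_const_mul, inv_mul_cancel₀ hpos.ne']
  · by_contra hsU
    have : f s = 0 := hf0 fun hsV => hsU (hVU hsV)
    exact hs (by simp [h, this])
  · simp [h, mul_comm]

theorem norm_integral_bump_sub_le {E : Type*} [NormedAddCommGroup E] [NormedSpace ℂ E]
    [CompleteSpace E] {k : C(G, ℝ)} (hk : ∀ s, 0 ≤ k s) (hk1 : ∫ s, k s ∂normHaar G = 1)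
    {F : G → E} (hF : Continuous F) {a : E} {ε : ℝ} (h : ∀ s, k s ≠ 0 → ‖F s - a‖ ≤ ε) :
    ‖∫ s, (k s : ℂ) • F s ∂normHaar G - a‖ ≤ ε := by
  have h1 : ∫ s, (k s : ℂ) • a ∂normHaar G = a := by
    rw [integral_smul_const, integral_complex_ofReal, hk1, Complex.ofReal_one, one_smul]
  have hkc : Continuous fun s => (k s : ℂ) := Complex.continuous_ofReal.comp k.continuous
  nth_rewrite 1 [← h1]
  rw [← integral_sub (f := fun s => (k s : ℂ) • F s) (g := fun s => (k s : ℂ) • a)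
    (integrable_normHaar (hkc.smul hF)) (integrable_normHaar (hkc.smul continuous_const))]
  calc _ ≤ ∫ s, k s * ε ∂normHaar G := by
        refine norm_integral_le_of_norm_le
          (integrable_normHaar (k.continuous.mul continuous_const)) (.of_forall fun s => ?_)
        rw [← smul_sub, norm_smul, Complex.norm_real, Real.norm_of_nonneg (hk s)]
        by_cases hs : k s = 0
        · simp [hs]
        · exact mul_le_mul_of_nonneg_left (h s hs) (hk s)
    _ = ε := by rw [integral_mul_const, hk1, one_mul]

end Haar

/-! ### Convergence of approximate units. -/

theorem tendsto_contraction_mul {A : Type*} [NonUnitalNormedRing A] {e u : ℕ → A} {a : A}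
    (he : ∀ n, ‖e n‖ ≤ 1) (hel : Tendsto (fun n => e n * a) atTop (𝓝 a))
    (hu : Tendsto u atTop (𝓝 a)) : Tendsto (fun n => e n * u n) atTop (𝓝 a) := by
  have h0 : Tendsto (fun n => e n * (u n - a)) atTop (𝓝 0) :=
    squeeze_zero_norm (fun n => (norm_mul_le_of_le (he n) le_rfl).trans (one_mul _).le)
      (tendsto_iff_norm_sub_tendsto_zero.1 hu)
  have := h0.add hel
  rw [zero_add] at this
  exact this.congr fun n => by rw [mul_sub, sub_add_cancel]

theorem tendsto_mul_contraction {A : Type*} [NonUnitalNormedRing A] {e u : ℕ → A} {a : A}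
    (he : ∀ n, ‖e n‖ ≤ 1) (her : Tendsto (fun n => a * e n) atTop (𝓝 a))
    (hu : Tendsto u atTop (𝓝 a)) : Tendsto (fun n => u n * e n) atTop (𝓝 a) := by
  have h0 : Tendsto (fun n => (u n - a) * e n) atTop (𝓝 0) :=
    squeeze_zero_norm (fun n => (norm_mul_le_of_le le_rfl (he n)).trans (mul_one _).le)
      (tendsto_iff_norm_sub_tendsto_zero.1 hu)
  have := h0.add her
  rw [zero_add] at this
  exact this.congr fun n => by rw [sub_mul, sub_add_cancel]

/-- Pointwise convergence of nonexpansive maps is uniform on compact sets. It is applied to the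
range of a function in `C(G, A)`. -/
theorem eventually_norm_sub_le_of_isCompact {A : Type*} [NormedAddCommGroup A] {u : ℕ → A → A}
    (hu : ∀ n a b, ‖u n a - u n b‖ ≤ ‖a - b‖) (hlim : ∀ a, Tendsto (fun n => u n a) atTop (𝓝 a))
    {K : Set A} (hK : IsCompact K) {ε : ℝ} (hε : 0 < ε) :
    ∀ᶠ n in atTop, ∀ a ∈ K, ‖u n a - a‖ ≤ ε := by
  refine hK.induction_on (p := fun s => ∀ᶠ n in atTop, ∀ a ∈ s, ‖u n a - a‖ ≤ ε) (by simp)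
    (fun s t hst h => h.mono fun n hn a ha => hn a (hst ha))
    (fun s t hs ht => (hs.and ht).mono fun n hn a ha => ha.elim (hn.1 a) (hn.2 a))
    (fun x _ => ⟨Metric.ball x (ε / 3),
      mem_nhdsWithin_of_mem_nhds (Metric.ball_mem_nhds x (by positivity)), ?_⟩)
  filter_upwards [Metric.tendsto_nhds.1 (hlim x) (ε / 3) (by positivity)] with n hn a ha
  rw [Metric.mem_ball, dist_eq_norm] at ha
  rw [dist_eq_norm] at hn
  calc ‖u n a - a‖ = ‖(u n a - u n x) + (u n x - x) - (a - x)‖ := by congr 1; abel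
    _ ≤ ‖u n a - u n x‖ + ‖u n x - x‖ + ‖a - x‖ :=
        (norm_sub_le _ _).trans (by gcongr; exact norm_add_le _ _)
    _ ≤ ε := by linarith [hu n a x]

/-! ### Fixed points and invariant approximate units -/

namespace CStarAction

variable {G : Type v} {A : Type u} [Group G] [TopologicalSpace G] [NonUnitalCStarAlgebra A]
variable (α : CStarAction G A)

theorem apply_inv_apply (g : G) (a : A) : α g (α g⁻¹ a) = a := by
  rw [← α.mul_apply, mul_inv_cancel, α.one_apply]

theorem isClosed_fixedPoints : IsClosed (α.fixedPoints : Set A) := by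
  have : (α.fixedPoints : Set A) = ⋂ g, {a | α g a = a} := by
    ext a; rw [Set.mem_iInter]; rfl
  rw [this]
  exact isClosed_iInter fun g => isClosed_eq (α.isometry_apply g).continuous continuous_id

variable [IsTopologicalGroup G] [CompactSpace G] [MeasurableSpace G] [BorelSpace G]

/-- The average of the orbit of `a`. -/
def avg (a : A) : A := ∫ g, α g a ∂normHaar G

theorem norm_avg_le (a : A) : ‖α.avg a‖ ≤ ‖a‖ :=
  norm_integral_normHaar_le fun g => (α.norm_apply g a).le

variable [SecondCountableTopology G]

theorem avg_mem (a : A) : α.avg a ∈ α.fixedPoints := fun g => by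
  rw [avg, ← ConvAlg.integral_act α g (α.continuous_apply a)]
  simp_rw [← α.mul_apply]
  exact integral_mul_left_eq_self (fun s => α s a) g

variable {α}

/-- Average an approximate unit over `G`: `avg(e_n) a = ∫ α_g(e_n α_{g⁻¹}(a)) dg`, whose integrand
tends to `a` pointwise and is bounded by `‖a‖`, so dominated convergence applies. -/
theorem exists_invariant_approximateUnit (hA : IsSigmaUnital A) (α : CStarAction G A) :
    ∃ e : ℕ → A, (∀ n, e n ∈ α.fixedPoints) ∧ (∀ n, ‖e n‖ ≤ 1) ∧
      (∀ a, Tendsto (fun n => e n * a) atTop (𝓝 a)) ∧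
      ∀ a, Tendsto (fun n => a * e n) atTop (𝓝 a) := by
  obtain ⟨e, he1, -, he⟩ := hA
  have hl : ∀ a, Tendsto (fun n => e n * a) atTop (𝓝 a) := fun a => he.tendsto_mul_right a
  have hr : ∀ a, Tendsto (fun n => a * e n) atTop (𝓝 a) := fun a => he.tendsto_mul_left a
  have hcont : ∀ (a : A), Continuous fun g => α g⁻¹ a := fun a =>
    (α.continuous_apply a).comp continuous_inv
  have dom : ∀ (u : ℕ → G → A) (a : A), (∀ n, Continuous (u n)) → (∀ n g, ‖u n g‖ ≤ ‖a‖) →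
      (∀ g, Tendsto (fun n => u n g) atTop (𝓝 a)) →
      Tendsto (fun n => ∫ g, u n g ∂normHaar G) atTop (𝓝 a) := by
    intro u a hc hb ht
    have := tendsto_integral_of_dominated_convergence (μ := normHaar G) (F := u) (f := fun _ => a)
      (fun _ => ‖a‖) (fun n => (integrable_normHaar (hc n)).aestronglyMeasurable)
      (integrable_const _) (fun n => .of_forall fun g => hb n g) (.of_forall fun g => ht g)
    simpa using this
  refine ⟨fun n => α.avg (e n), fun n => α.avg_mem _,
    fun n => (α.norm_avg_le _).trans (he1 n), fun a => ?_, fun a => ?_⟩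
  · have h := dom (fun n g => α g (e n * α g⁻¹ a)) a
      (fun n => α.continuous_uncurry.comp
        (continuous_id.prodMk (continuous_const.mul (hcont a))))
      (fun n g => by
        rw [α.norm_apply]
        exact (norm_mul_le_of_le (he1 n) (α.norm_apply _ _).le).trans (one_mul _).le)
      (fun g => by
        have := ((α.isometry_apply g).continuous.tendsto _).comp (hl (α g⁻¹ a))
        rwa [α.apply_inv_apply] at this)
    refine h.congr fun n => ?_
    rw [show (fun n => α.avg (e n)) n = ∫ g, α g (e n) ∂normHaar G from rfl,
      ← ConvAlg.integral_mul_right a (α.continuous_apply _)]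
    simp_rw [map_mul, α.apply_inv_apply]
  · have h := dom (fun n g => α g (α g⁻¹ a * e n)) a
      (fun n => α.continuous_uncurry.comp
        (continuous_id.prodMk ((hcont a).mul continuous_const)))
      (fun n g => by
        rw [α.norm_apply]
        exact (norm_mul_le_of_le (α.norm_apply _ _).le (he1 n)).trans (mul_one _).le)
      (fun g => by
        have := ((α.isometry_apply g).continuous.tendsto _).comp (hr (α g⁻¹ a))
        rwa [α.apply_inv_apply] at this)
    refine h.congr fun n => ?_
    rw [show (fun n => α.avg (e n)) n = ∫ g, α g (e n) ∂normHaar G from rfl,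
      ← ConvAlg.integral_mul_left a (α.continuous_apply _)]
    simp_rw [map_mul, α.apply_inv_apply]

end CStarAction

/-! ### Multipliers of the convolution algebra -/

namespace ConvAlg

set_option linter.unusedSectionVars false

variable {G : Type v} {A : Type u} [Group G] [TopologicalSpace G] [IsTopologicalGroup G]
  [CompactSpace G] [SecondCountableTopology G] [MeasurableSpace G] [BorelSpace G]
  [NonUnitalCStarAlgebra A] {α : CStarAction G A}

theorem norm_le_of_forall_norm_apply_le {f : ConvAlg α} {C : ℝ} (h : ∀ g, ‖f g‖ ≤ C) : ‖f‖ ≤ C := by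
  refine (isCStarSeminorm_univ.le_l1 f).trans ?_
  rw [l1Seminorm_apply]
  refine (integral_mono (integrable_normHaar f.cont.norm) (integrable_const C) h).trans ?_
  simp

@[simp] theorem sub_apply (f h : ConvAlg α) (g : G) : (f - h) g = f g - h g := rfl

@[simp] theorem sum_apply {ι : Type*} (s : Finset ι) (f : ι → ConvAlg α) (g : G) :
    (∑ i ∈ s, f i) g = ∑ i ∈ s, f i g :=
  ContinuousMap.sum_apply s f g

/-- Left multiplication by an element of `A`. -/
def lsmul (a : A) (f : ConvAlg α) : ConvAlg α :=
  (⟨fun g => a * f g, continuous_const.mul f.cont⟩ : C(G, A))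

/-- Right multiplication by an element of `A`. -/
def rsmul (f : ConvAlg α) (b : A) : ConvAlg α :=
  (⟨fun g => f g * α g b, f.cont.mul (α.continuous_apply b)⟩ : C(G, A))

variable (α) in
/-- The elementary tensor `k ⊗ c`. -/
def tens (k : C(G, ℂ)) (c : A) : ConvAlg α :=
  (⟨fun g => k g • c, k.continuous.smul continuous_const⟩ : C(G, A))

variable (α) in
/-- The constant function with value `c`. -/
def cst (c : A) : ConvAlg α := ContinuousMap.const G c

@[simp] theorem lsmul_apply (a : A) (f : ConvAlg α) (g : G) : lsmul a f g = a * f g := rfl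
@[simp] theorem rsmul_apply (f : ConvAlg α) (b : A) (g : G) : rsmul f b g = f g * α g b := rfl
@[simp] theorem tens_apply (k : C(G, ℂ)) (c : A) (g : G) : tens α k c g = k g • c := rfl
@[simp] theorem cst_apply (c : A) (g : G) : cst α c g = c := rfl

theorem lsmul_mul (a : A) (f h : ConvAlg α) : lsmul a f * h = lsmul a (f * h) := by
  ext g
  simp only [mul_apply, lsmul_apply, mul_assoc]
  exact integral_mul_left a (cont_integrand' f h g)

theorem mul_rsmul (f h : ConvAlg α) (b : A) : f * rsmul h b = rsmul (f * h) b := by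
  ext g
  simp only [mul_apply, rsmul_apply]
  rw [← integral_mul_right _ (cont_integrand' f h g)]
  refine integral_congr_ae (.of_forall fun s => ?_)
  beta_reduce
  rw [map_mul (α s), ← α.mul_apply, mul_inv_cancel_left, mul_assoc]

theorem norm_cst_le (c : A) : ‖cst α c‖ ≤ ‖c‖ := norm_le_of_forall_norm_apply_le fun _ => le_rfl

theorem cst_sub (c d : A) : cst α (c - d) = cst α c - cst α d := rfl

theorem mul_cst (f : ConvAlg α) {c : A} (hc : c ∈ α.fixedPoints) :
    f * cst α c = cst α ((∫ s, f s ∂normHaar G) * c) := by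
  ext g
  rw [mul_apply, cst_apply, ← integral_mul_right c f.cont]
  simp_rw [cst_apply, hc _]

theorem cst_mul_cst (c d : A) : cst α c * cst α d = cst α (c * α.avg d) := by
  ext g
  simp only [mul_apply, cst_apply]
  exact integral_mul_left c (α.continuous_apply d)

theorem cst_mul_cst_of_mem (c : A) {d : A} (hd : d ∈ α.fixedPoints) :
    cst α c * cst α d = cst α (c * d) := by
  rw [mul_cst _ hd]
  simp

/-- The compression formula for the corner: with `c` also fixed, the result is again a constant with
value in `A^α`. -/
theorem cst_mul_mul_cst (c : A) (f : ConvAlg α) {d : A} (hd : d ∈ α.fixedPoints) :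
    cst α c * f * cst α d = cst α (c * α.avg ((∫ s, f s ∂normHaar G) * d)) := by
  rw [mul_assoc, mul_cst f hd, cst_mul_cst]

theorem star_cst {c : A} (hc : c ∈ α.fixedPoints) : star (cst α c) = cst α (star c) := by
  ext g
  rw [star_apply, cst_apply, cst_apply]
  exact star_mem hc g

theorem norm_tens_le (k : C(G, ℂ)) (c : A) : ‖tens α k c‖ ≤ (∫ s, ‖k s‖ ∂normHaar G) * ‖c‖ := by
  refine (isCStarSeminorm_univ.le_l1 _).trans ?_
  rw [l1Seminorm_apply, ← integral_mul_const]
  simp [norm_smul]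

end ConvAlg

/-! ### Consequences of the Rokhlin property -/

theorem CStarAlgebra.norm_sq_le_of_star_mul_add {A : Type u} [NonUnitalCStarAlgebra A] (x y : A) :
    ‖x‖ ^ 2 ≤ ‖star x * x + star y * y‖ := by
  let _ := CStarAlgebra.spectralOrder A
  have _ := CStarAlgebra.spectralOrderedRing A
  rw [sq, ← CStarRing.norm_star_mul_self]
  exact CStarAlgebra.norm_le_norm_of_nonneg_of_le (star_mul_self_nonneg x)
    (le_add_of_nonneg_right (star_mul_self_nonneg y))

open scoped Pointwise in
theorem IsCompact.isSeparable_adjoin {A : Type u} [NonUnitalCStarAlgebra A] {K : Set A}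
    (hK : IsCompact K) :
    TopologicalSpace.IsSeparable (NonUnitalStarAlgebra.adjoin ℂ K : Set A) := by
  have hspan := NonUnitalStarAlgebra.adjoin_eq_span (R := ℂ) K
  -- `P n` is the compact set of words of length `n + 1`, which accounts for the index `m + n + 1`
  -- of a product.
  let P : ℕ → Set A := fun n => Nat.rec (K ∪ star K) (fun _ S => (K ∪ star K) * S) n
  have hKs : IsCompact (K ∪ star K) := by
    refine hK.union ?_
    rw [← Set.image_star]
    exact hK.image continuous_star
  have hP : ∀ n, IsCompact (P n) := by
    intro n
    induction n with
    | zero => exact hKs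
    | succ n ih => exact hKs.mul ih
  have hmul : ∀ m n x y, x ∈ P m → y ∈ P n → x * y ∈ P (m + n + 1) := by
    intro m
    induction m with
    | zero =>
      intro n x y hx hy
      rw [Nat.zero_add]
      exact Set.mul_mem_mul hx hy
    | succ m ih =>
      intro n x y hx hy
      obtain ⟨a, ha, b, hb, rfl⟩ := Set.mem_mul.1 hx
      rw [mul_assoc, show m + 1 + n + 1 = (m + n + 1) + 1 by omega]
      exact Set.mul_mem_mul ha (ih n b y hb hy)
  have hsub : (Subsemigroup.closure (K ∪ star K) : Set A) ⊆ ⋃ n, P n := by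
    intro x hx
    induction hx using Subsemigroup.closure_induction with
    | mem x hx => exact Set.mem_iUnion.2 ⟨0, hx⟩
    | mul x y _ _ hx hy =>
      obtain ⟨m, hm⟩ := Set.mem_iUnion.1 hx
      obtain ⟨n, hn⟩ := Set.mem_iUnion.1 hy
      exact Set.mem_iUnion.2 ⟨m + n + 1, hmul m n x y hm hn⟩
  have hsep : TopologicalSpace.IsSeparable (⋃ n, P n) :=
    .iUnion fun n => (hP n).isSeparable
  have h := (hsep.mono hsub).span (R := ℂ)
  rw [← hspan] at h
  exact h

namespace CStarAction

variable {G : Type v} {A : Type u} [Group G] [TopologicalSpace G] [NonUnitalCStarAlgebra A]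
variable (α : CStarAction G A)

/-- Every element lies in a separable invariant `C^*`-subalgebra. -/
theorem exists_separable_invariant [CompactSpace G] (c : A) :
    ∃ D : NonUnitalStarSubalgebra ℂ A, c ∈ D ∧ α.IsInvariant D ∧ IsClosed (D : Set A) ∧
      TopologicalSpace.IsSeparable (D : Set A) := by
  let K : Set A := Set.range fun g => α g c
  have hK : IsCompact K := isCompact_range (α.continuous_apply c)
  let D₀ := NonUnitalStarAlgebra.adjoin ℂ K
  have hinv : ∀ g, D₀ ≤ D₀.comap (α g : A →⋆ₙₐ[ℂ] A) := by
    intro g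
    refine NonUnitalStarAlgebra.adjoin_le ?_
    rintro _ ⟨h, rfl⟩
    change α g (α h c) ∈ D₀
    rw [← α.mul_apply]
    exact NonUnitalStarAlgebra.subset_adjoin ℂ K ⟨g * h, rfl⟩
  refine ⟨D₀.topologicalClosure, D₀.le_topologicalClosure
    (NonUnitalStarAlgebra.subset_adjoin ℂ K ⟨1, α.one_apply c⟩), fun g a ha => ?_,
    D₀.isClosed_topologicalClosure, hK.isSeparable_adjoin.closure⟩
  exact map_mem_closure (α.isometry_apply g).continuous ha (fun x hx => hinv g hx)

end CStarAction

/-! ### Bounded sequences representing elements of `F(D, A)`. -/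

section Lift

variable {G : Type v} {A : Type u} [Group G] [TopologicalSpace G] [NonUnitalCStarAlgebra A]
variable {α : CStarAction G A} {D : NonUnitalStarSubalgebra ℂ A}

/-- The bounded sequence `Y` represents the element `z` of `F(D, A)`. -/
def IsLift (Y : ℕ →ᵇ A) (z : FAlg D) : Prop :=
  ∃ h : etaSeq A Y ∈ relCommutant D, kappa D ⟨etaSeq A Y, h⟩ = z

namespace IsLift

variable {Y Y' : ℕ →ᵇ A} {z z' : FAlg D}

theorem add (h : IsLift Y z) (h' : IsLift Y' z') : IsLift (Y + Y') (z + z') := by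
  obtain ⟨h, rfl⟩ := h
  obtain ⟨h', rfl⟩ := h'
  exact ⟨add_mem h h', rfl⟩

theorem mul (h : IsLift Y z) (h' : IsLift Y' z') : IsLift (Y * Y') (z * z') := by
  obtain ⟨h, rfl⟩ := h
  obtain ⟨h', rfl⟩ := h'
  exact ⟨mul_mem h h', rfl⟩

theorem star (h : IsLift Y z) : IsLift (star Y) (star z) := by
  obtain ⟨h, rfl⟩ := h
  exact ⟨star_mem h, rfl⟩

theorem smul (h : IsLift Y z) (c : ℂ) : IsLift (c • Y) (c • z) := by
  obtain ⟨h, rfl⟩ := h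
  exact ⟨SMulMemClass.smul_mem c h, rfl⟩

theorem zero : IsLift (0 : ℕ →ᵇ A) (0 : FAlg D) :=
  ⟨zero_mem (relCommutant D), map_zero (kappa D)⟩

theorem sum {ι : Type*} (s : Finset ι) {Y : ι → ℕ →ᵇ A} {z : ι → FAlg D}
    (h : ∀ i, IsLift (Y i) (z i)) : IsLift (∑ i ∈ s, Y i) (∑ i ∈ s, z i) := by
  classical
  induction s using Finset.induction_on with
  | empty => exact zero
  | insert i s hi ih =>
    rw [Finset.sum_insert hi, Finset.sum_insert hi]
    exact (h i).add ih

theorem act (hD : α.IsInvariant D) (g : G) (h : IsLift Y z) :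
    IsLift (α.linfAct g Y) (α.fAct D hD g z) := by
  obtain ⟨h, rfl⟩ := h
  exact ⟨α.seqAct_mem_relCommutant D hD g h, rfl⟩

theorem tendsto_of_eta_eq {Y Y' : ℕ →ᵇ A} (h : etaSeq A Y = etaSeq A Y') :
    Tendsto (fun n => Y n - Y' n) atTop (𝓝 0) :=
  tendsto_zero_iff_norm_tendsto_zero.2 ((c₀Ideal A).mkₗ_eq_iff.1 h)

theorem commute (h : IsLift Y z) {d : A} (hd : d ∈ D) :
    Tendsto (fun n => Y n * d - d * Y n) atTop (𝓝 0) := by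
  obtain ⟨h, -⟩ := h
  refine tendsto_of_eta_eq (Y := Y * BoundedContinuousFunction.const ℕ d)
    (Y' := BoundedContinuousFunction.const ℕ d * Y) ?_
  rw [map_mul, map_mul]
  exact h d hd

/-- Two representatives differ by an element of the annihilator of `D`, so they are comparable only
after multiplication by an element of `D`. -/
theorem unique (h : IsLift Y z) (h' : IsLift Y' z) {d : A} (hd : d ∈ D) :
    Tendsto (fun n => Y n * d - Y' n * d) atTop (𝓝 0) := by
  obtain ⟨h, rfl⟩ := h
  obtain ⟨h', e⟩ := h'
  have := ((annIdeal D).mkₗ_eq_iff.1 e.symm d hd).1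
  refine tendsto_of_eta_eq (Y := Y * BoundedContinuousFunction.const ℕ d)
    (Y' := Y' * BoundedContinuousFunction.const ℕ d) ?_
  rw [map_mul, map_mul, ← sub_eq_zero, ← sub_mul]
  exact this

end IsLift

end Lift

namespace CStarAction

variable {G : Type v} {A : Type u} [Group G] [TopologicalSpace G] [NonUnitalCStarAlgebra A]
variable {α : CStarAction G A} {D : NonUnitalStarSubalgebra ℂ A}

theorem exists_isLift_of_mem_fCont {z : FAlg D} (hz : z ∈ α.fCont D) :
    ∃ Y ∈ α.linfCont, IsLift Y z := by
  obtain ⟨y, hy, rfl⟩ := hz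
  obtain ⟨Y, hY, hYy⟩ := hy
  have h : etaSeq A Y = y.1 := hYy
  exact ⟨Y, hY, by rw [h]; exact y.2, congrArg (kappa D) (Subtype.ext h)⟩

section Unital

variable {φ : C(G, ℂ) →⋆ₙₐ[ℂ] α.fCont D}

/-- Unitality of `φ` is only relative to `F_α(D, A)`, so an element of that algebra acting as a unit
on `D` is required. An invariant approximate unit `W` gives one: `φ 1 * [W] = [W]` yields `Y_n e_n d
- e_n d → 0`, and `e_n d → d`. -/
theorem tendsto_lift_one_mul [IsTopologicalGroup G] [CompactSpace G] [MeasurableSpace G]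
    [BorelSpace G] [SecondCountableTopology G]
    (hA : IsSigmaUnital A) (hφ : ∀ x : α.fCont D, φ 1 * x = x ∧ x * φ 1 = x) {Y : ℕ →ᵇ A}
    (hY : IsLift Y (φ 1 : FAlg D)) {d : A} (hd : d ∈ D) :
    Tendsto (fun n => Y n * d) atTop (𝓝 d) := by
  obtain ⟨e, hefix, he1, hel, her⟩ := exists_invariant_approximateUnit hA α
  let W : ℕ →ᵇ A := BoundedContinuousFunction.ofNormedAddCommGroup e
    continuous_of_discreteTopology 1 he1
  have hW : ∀ n, W n = e n := fun _ => rfl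
  have hWc : W ∈ α.linfCont := by
    have : ∀ g, α.linfAct g W = W := fun g => by ext n; exact hefix n g
    change Continuous fun g => α.linfAct g W
    simp_rw [this]
    exact continuous_const
  have hWD : etaSeq A W ∈ relCommutant D := by
    intro d _
    rw [constSeq, ← map_mul, ← map_mul]
    refine (c₀Ideal A).mkₗ_eq_iff.2 (tendsto_zero_iff_norm_tendsto_zero.1 ?_)
    have := (hel d).sub (her d)
    rwa [sub_self] at this
  have hz : kappa D ⟨etaSeq A W, hWD⟩ ∈ α.fCont D :=
    ⟨⟨etaSeq A W, hWD⟩, ⟨W, hWc, rfl⟩, rfl⟩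
  have hl : IsLift W (kappa D ⟨etaSeq A W, hWD⟩) := ⟨hWD, rfl⟩
  have h1 : (φ 1 : FAlg D) * kappa D ⟨etaSeq A W, hWD⟩ = kappa D ⟨etaSeq A W, hWD⟩ :=
    congrArg Subtype.val (hφ ⟨_, hz⟩).1
  have h2 := hY.mul hl
  rw [h1] at h2
  have h3 : Tendsto (fun n => Y n * (d - e n * d)) atTop (𝓝 0) := by
    refine squeeze_zero_norm (a := fun n => ‖Y‖ * ‖d - e n * d‖) (fun n => ?_) ?_
    · exact norm_mul_le_of_le (Y.norm_coe_le_norm n) le_rfl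
    · have := ((tendsto_const_nhds (x := d)).sub (hel d)).norm.const_mul ‖Y‖
      simpa using this
  have := (h3.add (h2.unique hl hd)).add (hel d)
  rw [add_zero, zero_add] at this
  refine this.congr fun n => ?_
  rw [BoundedContinuousFunction.mul_apply, hW, mul_sub, mul_assoc]
  abel

/-- Contractivity of `φ`, expressed through representatives because `F(D, A)` is used here as a
`*`-algebra without norm. The bound comes from completing `|r|²` to the constant `ε²` by a second
square and using monotonicity of the norm on positive elements. -/
theorem eventually_norm_lift_mul_le
    (hX : ∀ f, ∃ Y : ℕ →ᵇ A, IsLift Y (φ f : FAlg D)) {d : A} (hd : d ∈ D)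
    (h1 : ∀ Y : ℕ →ᵇ A, IsLift Y (φ 1 : FAlg D) → Tendsto (fun n => Y n * d) atTop (𝓝 d))
    {r : C(G, ℂ)} {ε : ℝ} (hr : ∀ g, ‖r g‖ ≤ ε) {Y : ℕ →ᵇ A} (hY : IsLift Y (φ r : FAlg D))
    {η : ℝ} (hη : ε * ‖d‖ < η) :
    ∀ᶠ n in atTop, ‖Y n * d‖ ≤ η := by
  have hε : 0 ≤ ε := (norm_nonneg _).trans (hr 1)
  have hη0 : 0 ≤ η := (mul_nonneg hε (norm_nonneg d)).trans hη.le
  -- Chosen so that `r* r + s* s = ε² 1`.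
  let s : C(G, ℂ) := ⟨fun g => ((√(ε ^ 2 - ‖r g‖ ^ 2) : ℝ) : ℂ), by fun_prop⟩
  have hs : star r * r + star s * s = ((ε ^ 2 : ℝ) : ℂ) • (1 : C(G, ℂ)) := by
    ext g
    have h0 : 0 ≤ ε ^ 2 - ‖r g‖ ^ 2 := sub_nonneg.2 (pow_le_pow_left₀ (norm_nonneg _) (hr g) 2)
    have e1 : star (r g) * r g = ((‖r g‖ ^ 2 : ℝ) : ℂ) := by
      rw [Complex.star_def, Complex.conj_mul']; push_cast; rfl
    have e2 : star (s g) * s g = ((ε ^ 2 - ‖r g‖ ^ 2 : ℝ) : ℂ) := by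
      change star ((√(ε ^ 2 - ‖r g‖ ^ 2) : ℝ) : ℂ) * ((√(ε ^ 2 - ‖r g‖ ^ 2) : ℝ) : ℂ) = _
      rw [Complex.star_def, Complex.conj_ofReal, ← Complex.ofReal_mul, Real.mul_self_sqrt h0]
    change star (r g) * r g + star (s g) * s g = ((ε ^ 2 : ℝ) : ℂ) * 1
    rw [e1, e2, ← Complex.ofReal_add, mul_one, add_sub_cancel]
  obtain ⟨S, hS⟩ := hX s
  obtain ⟨U, hU⟩ := hX 1
  have hl := (hY.star.mul hY).add (hS.star.mul hS)
  have e : star (φ r : FAlg D) * (φ r : FAlg D) + star (φ s : FAlg D) * (φ s : FAlg D) =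
      ((ε ^ 2 : ℝ) : ℂ) • (φ 1 : FAlg D) := by
    have h0 : star (φ r) * φ r + star (φ s) * φ s = ((ε ^ 2 : ℝ) : ℂ) • φ 1 := by
      rw [← map_star, ← map_star, ← map_mul, ← map_mul, ← map_add, hs, map_smul]
    exact congrArg Subtype.val h0
  rw [e] at hl
  have h2 := (hl.unique (hU.smul ((ε ^ 2 : ℝ) : ℂ)) hd).add ((h1 U hU).const_smul ((ε ^ 2 : ℝ) : ℂ))
  rw [zero_add] at h2
  have h3 := (h2.const_mul (star d)).norm
  have h4 : ‖star d * ((ε ^ 2 : ℝ) : ℂ) • d‖ < η ^ 2 := by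
    rw [mul_smul_comm, norm_smul, CStarRing.norm_star_mul_self, Complex.norm_real,
      Real.norm_of_nonneg (sq_nonneg ε), ← sq, ← mul_pow]
    exact pow_lt_pow_left₀ hη (mul_nonneg hε (norm_nonneg d)) two_ne_zero
  filter_upwards [h3.eventually_lt_const h4] with n hn
  refine (pow_le_pow_iff_left₀ (norm_nonneg _) hη0 two_ne_zero).1 ?_
  refine (CStarAlgebra.norm_sq_le_of_star_mul_add (Y n * d) (S n * d)).trans (le_of_eq_of_le ?_ hn.le)
  congr 1
  simp only [BoundedContinuousFunction.add_apply, BoundedContinuousFunction.mul_apply,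
    BoundedContinuousFunction.star_apply, BoundedContinuousFunction.smul_apply, star_mul, add_mul,
    mul_add, mul_sub, mul_assoc, smul_mul_assoc, mul_smul_comm]
  abel

end Unital

/-- Continuity of `Ψ` in the supremum norm makes the estimates at nearby points uniform in `n`, so
finitely many points suffice. This is where the continuous part `A_{∞, α}` matters. -/
theorem _root_.eventually_forall_of_compact {X : Type*} [TopologicalSpace X] [CompactSpace X]
    {B : Type*} [SeminormedAddCommGroup B] {Ψ : X → ℕ →ᵇ B} (hΨ : Continuous Ψ) {ε δ : ℝ}
    (hδ : δ < ε) (h : ∀ x, ∀ᶠ n in atTop, ‖Ψ x n‖ ≤ δ) :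
    ∀ᶠ n in atTop, ∀ x, ‖Ψ x n‖ ≤ ε := by
  have := isCompact_univ.induction_on (p := fun s => ∀ᶠ n in atTop, ∀ x ∈ s, ‖Ψ x n‖ ≤ ε) (by simp)
    (fun s t hst h => h.mono fun n hn a ha => hn a (hst ha))
    (fun s t hs ht => (hs.and ht).mono fun n hn a ha => ha.elim (hn.1 a) (hn.2 a))
    (fun x _ => ⟨Ψ ⁻¹' Metric.ball (Ψ x) (ε - δ), mem_nhdsWithin_of_mem_nhds
      (hΨ.continuousAt (Metric.ball_mem_nhds _ (sub_pos.2 hδ))), ?_⟩)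
  · exact this.mono fun n hn x => hn x trivial
  · filter_upwards [h x] with n hn y hy
    rw [Set.mem_preimage, Metric.mem_ball, dist_eq_norm] at hy
    have h1 := (Ψ y - Ψ x).norm_coe_le_norm n
    rw [BoundedContinuousFunction.sub_apply] at h1
    have h2 := norm_add_le (Ψ y n - Ψ x n) (Ψ x n)
    rw [sub_add_cancel] at h2
    linarith

/-- Saturation: under the Rokhlin property every function `g ↦ k(g) c` is a uniform limit of finite
sums of functions of the form `g ↦ a c α_g(b)`. -/
theorem HasRokhlinProperty.exists_approx [IsTopologicalGroup G] [CompactSpace G]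
    [MeasurableSpace G] [BorelSpace G] [SecondCountableTopology G]
    (hA : IsSigmaUnital A) (hα : α.HasRokhlinProperty) (c : A)
    (k : C(G, ℂ)) {ε : ℝ} (hε : 0 < ε) :
    ∃ (m : ℕ) (a b : Fin m → A), ∀ g, ‖k g • c - ∑ i, a i * c * α g (b i)‖ ≤ ε := by
  obtain ⟨D, hc, hD, hDc, hDs⟩ := α.exists_separable_invariant c
  obtain ⟨φ, hφ1, hφg⟩ := hα D hD hDc hDs
  choose X hXc hX using fun f => exists_isLift_of_mem_fCont (φ f).2
  have hone : ∀ d ∈ D, ∀ Y : ℕ →ᵇ A, IsLift Y (φ 1 : FAlg D) →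
      Tendsto (fun n => Y n * d) atTop (𝓝 d) :=
    fun d hd Y hY => tendsto_lift_one_mul hA hφ1 hY hd
  -- Evaluating `F h` at `g⁻¹ * h` gives `k g`. A finite approximation of `F` therefore approximates
  -- the constant `k g` by `∑ ρ i * leftTranslate g (η i)`, uniformly in `g`.
  let F : G → C(G, ℂ) := fun u => ⟨fun v => k (u * v⁻¹), by fun_prop⟩
  have hF : Continuous F := ContinuousMap.continuous_of_continuous_uncurry _
    (by change Continuous fun p : G × G => k (p.1 * p.2⁻¹); fun_prop)
  have hε₁ : 0 < ε / (4 * (‖c‖ + 1)) := by positivity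
  obtain ⟨m, ρ, x, hρ⟩ := exists_finite_approx hF hε₁
  let η : Fin m → C(G, ℂ) := fun i => F (x i)
  let r : G → C(G, ℂ) := fun g => ∑ i, ρ i * leftTranslate g (η i) - k g • 1
  have hr : ∀ g h, ‖r g h‖ ≤ ε / (4 * (‖c‖ + 1)) := by
    intro g h
    have h1 := ((F h - ∑ i, ρ i h • F (x i)).norm_coe_le_norm (g⁻¹ * h)).trans (hρ h)
    rw [← norm_neg] at h1
    refine le_of_eq_of_le (congrArg norm ?_) h1
    simp [r, η, F, leftTranslate, ContinuousMap.sum_apply]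
  -- By equivariance this represents `φ (r g)`, which is small, so `Y g n * c` is eventually small.
  let Y : G → ℕ →ᵇ A := fun g => ∑ i, X (ρ i) * α.linfAct g (X (η i)) + (-k g) • X 1
  have hY : ∀ g, IsLift (Y g) (φ (r g) : FAlg D) := by
    intro g
    have e : (φ (r g) : FAlg D) =
        ∑ i, (φ (ρ i) : FAlg D) * α.fAct D hD g (φ (η i) : FAlg D) + (-k g) • (φ 1 : FAlg D) := by
      simp_rw [← hφg]
      simp [r, sub_eq_add_neg]
    rw [e]
    exact (IsLift.sum _ fun i => (hX (ρ i)).mul ((hX (η i)).act hD g)).add ((hX 1).smul _)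
  let Ψ : G → ℕ →ᵇ A := fun g =>
    k g • BoundedContinuousFunction.const ℕ c -
      ∑ i, X (ρ i) * BoundedContinuousFunction.const ℕ c * α.linfAct g (X (η i))
  have hΨ : Continuous Ψ := by
    refine (k.continuous.smul continuous_const).sub (continuous_finsetSum _ fun i _ => ?_)
    exact continuous_const.mul (hXc (η i))
  -- The two errors are the commutators of `c` with the translated representatives and the defect of
  -- `X 1` as a left unit for `c`.
  have hlim : ∀ g, Tendsto (fun n => Ψ g n + Y g n * c) atTop (𝓝 0) := by
    intro g
    have h1 : Tendsto (fun n => ∑ i, X (ρ i) n * (α.linfAct g (X (η i)) n * c -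
        c * α.linfAct g (X (η i)) n)) atTop (𝓝 0) := by
      rw [← Finset.sum_const_zero (s := (Finset.univ : Finset (Fin m)))]
      refine tendsto_finsetSum _ fun i _ => ?_
      have h2 := ((hX (η i)).act hD g).commute hc
      refine squeeze_zero_norm (fun n => norm_mul_le_of_le ((X (ρ i)).norm_coe_le_norm n) le_rfl) ?_
      simpa using h2.norm.const_mul ‖X (ρ i)‖
    have h2 := ((tendsto_const_nhds (x := c)).sub (hone c hc _ (hX 1))).const_smul (k g)
    rw [sub_self, smul_zero] at h2
    have h3 := h1.add h2
    rw [add_zero] at h3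
    refine h3.congr fun n => ?_
    simp only [Ψ, Y, BoundedContinuousFunction.sub_apply, BoundedContinuousFunction.add_apply,
      BoundedContinuousFunction.sum_apply, BoundedContinuousFunction.mul_apply,
      BoundedContinuousFunction.smul_apply, BoundedContinuousFunction.const_apply,
      BoundedContinuousFunction.neg_apply, add_mul,
      Finset.sum_mul, mul_sub, smul_sub, Finset.sum_sub_distrib, smul_mul_assoc, neg_smul, neg_mul,
      mul_assoc]
    abel
  have hpt : ∀ g, ∀ᶠ n in atTop, ‖Ψ g n‖ ≤ 3 * ε / 4 := by
    intro g
    have h1 : ε / (4 * (‖c‖ + 1)) * ‖c‖ < ε / 4 := by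
      rw [div_mul_eq_mul_div, div_lt_div_iff₀ (by positivity) (by positivity)]
      nlinarith [norm_nonneg c]
    filter_upwards [eventually_norm_lift_mul_le (fun f => ⟨X f, hX f⟩) hc (hone c hc) (hr g) (hY g)
      h1, ((hlim g).norm.eventually_lt_const (u := ε / 4) (by simpa using hε))] with n h2 h3
    have h4 := norm_sub_le (Ψ g n + Y g n * c) (Y g n * c)
    rw [add_sub_cancel_right] at h4
    linarith
  obtain ⟨n, hn⟩ := (eventually_forall_of_compact hΨ (by linarith : 3 * ε / 4 < ε) hpt).exists
  refine ⟨m, fun i => X (ρ i) n, fun i => X (η i) n, fun g => ?_⟩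
  have := hn g
  simpa only [Ψ, BoundedContinuousFunction.sub_apply, BoundedContinuousFunction.sum_apply,
    BoundedContinuousFunction.mul_apply, BoundedContinuousFunction.smul_apply,
    BoundedContinuousFunction.const_apply, linfAct_apply] using this

end CStarAction

/-! ### A lower bound for the universal norm -/

namespace ConvAlg

set_option linter.unusedSectionVars false

variable {G : Type v} {A : Type u} [Group G] [TopologicalSpace G] [IsTopologicalGroup G]
  [CompactSpace G] [SecondCountableTopology G] [MeasurableSpace G] [BorelSpace G]
  [NonUnitalCStarAlgebra A] {α : CStarAction G A}

/-- The `A`-valued inner product of the regular representation. -/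
def innerA (f h : ConvAlg α) : A := (star f * h) 1

theorem innerA_eq_integral (f h : ConvAlg α) :
    innerA f h = ∫ s, α s (star (f s⁻¹) * h s⁻¹) ∂normHaar G := by
  simp [innerA, mul_apply, star_apply]

theorem innerA_add_right (f h k : ConvAlg α) : innerA f (h + k) = innerA f h + innerA f k := by
  simp [innerA, mul_add]

theorem innerA_smul_right (f h : ConvAlg α) (c : ℂ) : innerA f (c • h) = c • innerA f h := by
  simp [innerA, mul_smul_comm]

theorem innerA_rsmul (f h : ConvAlg α) (a : A) : innerA f (rsmul h a) = innerA f h * a := by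
  simp only [innerA, mul_rsmul, rsmul_apply, α.one_apply]

theorem star_innerA (f h : ConvAlg α) : star (innerA f h) = innerA h f := by
  rw [innerA, innerA, ← star_star (star h * f), star_mul, star_star, star_apply, α.one_apply,
    inv_one]

theorem innerA_add_left (f h k : ConvAlg α) : innerA (f + h) k = innerA f k + innerA h k := by
  rw [← star_innerA, innerA_add_right, star_add, star_innerA, star_innerA]

theorem innerA_mul (b f h : ConvAlg α) : innerA f (b * h) = innerA (star b * f) h := by
  rw [innerA, innerA, star_mul, star_star, mul_assoc]

theorem innerA_self_nonneg [PartialOrder A] [StarOrderedRing A] (f : ConvAlg α) :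
    0 ≤ innerA f f := by
  rw [innerA_eq_integral]
  refine integral_nonneg fun s => ?_
  change 0 ≤ α s (star (f s⁻¹) * f s⁻¹)
  rw [map_mul, map_star]
  exact star_mul_self_nonneg _

/-- The seminorm of the regular representation. -/
def regNorm (f : ConvAlg α) : ℝ := √‖innerA f f‖

theorem regNorm_nonneg (f : ConvAlg α) : 0 ≤ regNorm f := Real.sqrt_nonneg _

theorem regNorm_sq (f : ConvAlg α) : regNorm f ^ 2 = ‖innerA f f‖ := Real.sq_sqrt (norm_nonneg _)

/-- Cauchy–Schwarz for an `A`-valued inner product. -/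
theorem norm_innerA_le (f h : ConvAlg α) : ‖innerA f h‖ ≤ regNorm f * regNorm h := by
  let _ := CStarAlgebra.spectralOrder A
  have _ := CStarAlgebra.spectralOrderedRing A
  have key : ∀ M : ℝ, ‖innerA f f‖ < M → ‖innerA f h‖ ^ 2 ≤ M * ‖innerA h h‖ := by
    intro M hM
    have hM0 : 0 < M := (norm_nonneg _).trans_lt hM
    set y := innerA f h with hy
    -- Positivity of the inner square of `h + f x` with this `x` gives `y* y ≤ M ⟨h, h⟩`. Taking `M`
    -- strictly above `‖⟨f, f⟩‖` avoids dividing by zero; the limit is taken at the end.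
    let x : A := ((-M⁻¹ : ℝ) : ℂ) • y
    have h1 := innerA_self_nonneg (h + rsmul f x)
    rw [innerA_add_right, innerA_add_left, innerA_add_left, innerA_rsmul, innerA_rsmul,
      ← star_innerA h (rsmul f x), innerA_rsmul, ← star_innerA f (rsmul f x), innerA_rsmul,
      star_mul, star_mul, star_innerA, star_innerA, ← star_innerA f h, ← hy] at h1
    have h2 : star x * innerA f f * x ≤ M • (star x * x) :=
      (CStarAlgebra.star_left_conjugate_le_norm_smul
        (IsSelfAdjoint.of_nonneg (innerA_self_nonneg f))).trans
        (smul_le_smul_of_nonneg_right hM.le (star_mul_self_nonneg x))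
    have e1 : star x = ((-M⁻¹ : ℝ) : ℂ) • star y := by
      simp only [x, star_smul, Complex.star_def, Complex.conj_ofReal]
    have h3 : star y * y ≤ M • innerA h h := by
      have h4 : 0 ≤ innerA h h + -(M⁻¹ • (star y * y)) := by
        calc 0 ≤ _ := h1
          _ ≤ innerA h h + star x * y + (star y * x + M • (star x * x)) := by
            gcongr
          _ = _ := by
            rw [e1]
            simp only [x, smul_mul_assoc, mul_smul_comm, smul_smul, ← Complex.coe_smul,
              ← Complex.ofReal_mul]
            rw [add_assoc, ← add_smul, ← add_smul, ← neg_smul]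
            congr 2
            rw [← Complex.ofReal_add, ← Complex.ofReal_add, ← Complex.ofReal_neg]
            congr 1
            field_simp
            ring
      rw [← sub_eq_add_neg, sub_nonneg] at h4
      have h5 := smul_le_smul_of_nonneg_left h4 hM0.le
      rwa [smul_smul, mul_inv_cancel₀ hM0.ne', one_smul] at h5
    have h6 := CStarAlgebra.norm_le_norm_of_nonneg_of_le (star_mul_self_nonneg y) h3
    rwa [CStarRing.norm_star_mul_self, norm_smul, Real.norm_of_nonneg hM0.le, ← sq] at h6
  refine (pow_le_pow_iff_left₀ (norm_nonneg _)
    (mul_nonneg (regNorm_nonneg f) (regNorm_nonneg h)) two_ne_zero).1 ?_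
  rw [mul_pow, regNorm_sq, regNorm_sq]
  have hc : ContinuousWithinAt (fun M : ℝ => M * ‖innerA h h‖) (Set.Ioi ‖innerA f f‖) ‖innerA f f‖ :=
    by fun_prop
  exact ge_of_tendsto hc.tendsto (eventually_mem_nhdsWithin.mono key)

theorem regNorm_add_le (f h : ConvAlg α) : regNorm (f + h) ≤ regNorm f + regNorm h := by
  refine (pow_le_pow_iff_left₀ (regNorm_nonneg _)
    (add_nonneg (regNorm_nonneg f) (regNorm_nonneg h)) two_ne_zero).1 ?_
  rw [regNorm_sq, innerA_add_right, innerA_add_left, innerA_add_left]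
  refine (norm_add_le_of_le (norm_add_le _ _) (norm_add_le _ _)).trans ?_
  nlinarith [norm_innerA_le f h, norm_innerA_le h f, regNorm_sq f, regNorm_sq h]

theorem regNorm_smul (c : ℂ) (f : ConvAlg α) : regNorm (c • f) = ‖c‖ * regNorm f := by
  rw [regNorm, innerA_smul_right, ← star_innerA, innerA_smul_right, norm_smul, norm_star, norm_smul,
    ← mul_assoc, Real.sqrt_mul (by positivity), Real.sqrt_mul_self (norm_nonneg c), ← regNorm]

/-- The translation `u_s f`. -/
def translate (s : G) (f : ConvAlg α) : ConvAlg α :=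
  (⟨fun g => α s (f (s⁻¹ * g)), cont_act α continuous_const (by fun_prop)⟩ : C(G, A))

theorem translate_apply (s : G) (f : ConvAlg α) (g : G) : translate s f g = α s (f (s⁻¹ * g)) := rfl

theorem regNorm_translate (s : G) (f : ConvAlg α) : regNorm (translate s f) = regNorm f := by
  have : innerA (translate s f) (translate s f) = innerA f f := by
    rw [innerA_eq_integral, innerA_eq_integral,
      ← integral_mul_right_eq_self (fun t => α t (star (f t⁻¹) * f t⁻¹)) s]
    refine integral_congr_ae (.of_forall fun t => ?_)
    simp only [translate_apply]
    rw [← map_star, ← map_mul, ← α.mul_apply, mul_inv_rev]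
  rw [regNorm, this, regNorm]

theorem regNorm_lsmul_le (a : A) (f : ConvAlg α) : regNorm (lsmul a f) ≤ ‖a‖ * regNorm f := by
  let _ := CStarAlgebra.spectralOrder A
  have _ := CStarAlgebra.spectralOrderedRing A
  refine (pow_le_pow_iff_left₀ (regNorm_nonneg _)
    (mul_nonneg (norm_nonneg a) (regNorm_nonneg f)) two_ne_zero).1 ?_
  have hle : innerA (lsmul a f) (lsmul a f) ≤ (‖a‖ ^ 2) • innerA f f := by
    rw [innerA_eq_integral, innerA_eq_integral, ← integral_smul]
    refine integral_mono (integrable_normHaar ?_) (integrable_normHaar ?_) fun s => ?_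
    · exact cont_act α continuous_id (by fun_prop)
    · exact (cont_act α continuous_id (by fun_prop)).const_smul _
    · have h := CStarAlgebra.star_left_conjugate_le_norm_smul (a := α s (f s⁻¹))
        (b := α s (star a * a)) (.of_nonneg (by
          rw [map_mul, map_star]; exact star_mul_self_nonneg _))
      rw [α.norm_apply, CStarRing.norm_star_mul_self, ← sq, ← map_star, ← map_mul, ← map_mul,
        ← map_mul] at h
      simpa only [lsmul_apply, star_mul, mul_assoc] using h
  rw [mul_pow, regNorm_sq, regNorm_sq]
  have := CStarAlgebra.norm_le_norm_of_nonneg_of_le (innerA_self_nonneg _) hle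
  rwa [norm_smul, Real.norm_of_nonneg (sq_nonneg _)] at this

/-- Convolution by `b` is the weak integral of the operators `b(s) u_s`, by Fubini. Together with
the bounds for `lsmul` and `translate` this yields domination by the `L¹`-norm. -/
theorem innerA_mul_eq_integral (b f h : ConvAlg α) :
    innerA h (b * f) = ∫ s, innerA h (lsmul (b s) (translate s f)) ∂normHaar G := by
  simp only [innerA_eq_integral, lsmul_apply, translate_apply]
  rw [← integral_swap_normHaar (f := fun t s => α t (star (h t⁻¹) * (b s * α s (f (s⁻¹ * t⁻¹)))))]
  · refine integral_congr_ae (.of_forall fun t => ?_)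
    have hc : Continuous fun s => b s * α s (f (s⁻¹ * t⁻¹)) := cont_integrand' b f t⁻¹
    exact ((integral_act α t (continuous_const.mul hc)).trans
      (congrArg (α t) (integral_mul_left (star (h t⁻¹)) hc))).symm
  · refine cont_act α continuous_fst (Continuous.mul (by fun_prop) (Continuous.mul (by fun_prop) ?_))
    exact cont_act α continuous_snd (by fun_prop)

theorem regNorm_mul_le_l1 (b f : ConvAlg α) : regNorm (b * f) ≤ l1Seminorm α b * regNorm f := by
  rcases (regNorm_nonneg (b * f)).eq_or_lt with h0 | h0
  · rw [← h0]; exact mul_nonneg (apply_nonneg _ _) (regNorm_nonneg f)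
  refine le_of_mul_le_mul_left ?_ h0
  have h : ‖innerA (b * f) (b * f)‖ ≤ ∫ s, ‖b s‖ * (regNorm (b * f) * regNorm f) ∂normHaar G := by
    rw [innerA_mul_eq_integral]
    refine norm_integral_le_of_norm_le
      (integrable_normHaar (b.cont.norm.mul continuous_const)) (.of_forall fun s => ?_)
    refine (norm_innerA_le _ _).trans ?_
    rw [mul_left_comm]
    refine mul_le_mul_of_nonneg_left ((regNorm_lsmul_le _ _).trans ?_) (regNorm_nonneg _)
    rw [regNorm_translate]
  rw [← sq, regNorm_sq]
  refine h.trans (le_of_eq ?_)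
  rw [integral_mul_const, l1Seminorm_apply]
  ring

/-- Adjointness, `⟨b f, b f⟩ = ⟨f, b* b f⟩` up to star, followed by Cauchy–Schwarz; this gives the
`C^*`-identity of the operator seminorm. -/
theorem regNorm_mul_sq_le (b f : ConvAlg α) :
    regNorm (b * f) ^ 2 ≤ regNorm f * regNorm (star b * b * f) := by
  rw [regNorm_sq, innerA_mul, ← mul_assoc, ← star_innerA, norm_star]
  exact norm_innerA_le _ _

/-- The seminorm `b ↦ N(b * f)`. -/
def regSeminormAt (f : ConvAlg α) : Seminorm ℂ (ConvAlg α) :=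
  Seminorm.of (fun b => regNorm (b * f))
    (fun b c => by rw [add_mul]; exact regNorm_add_le _ _)
    (fun c b => by rw [smul_mul_assoc]; exact regNorm_smul _ _)

variable (α) in
/-- The operator seminorm of the regular representation. -/
def regSeminorm : Seminorm ℂ (ConvAlg α) :=
  sSup (regSeminormAt '' {f : ConvAlg α | regNorm f ≤ 1})

theorem bddAbove_regSeminormAt :
    BddAbove (regSeminormAt '' {f : ConvAlg α | regNorm f ≤ 1}) := by
  refine ⟨l1Seminorm α, ?_⟩
  rintro _ ⟨f, hf, rfl⟩ b
  exact (regNorm_mul_le_l1 b f).trans (mul_le_of_le_one_right (apply_nonneg _ _) hf)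

theorem regSeminorm_le {b : ConvAlg α} {C : ℝ}
    (h : ∀ f : ConvAlg α, regNorm f ≤ 1 → regNorm (b * f) ≤ C) : regSeminorm α b ≤ C := by
  rw [regSeminorm, Seminorm.sSup_apply bddAbove_regSeminormAt]
  have : Nonempty (regSeminormAt '' {f : ConvAlg α | regNorm f ≤ 1}) :=
    ⟨⟨_, 0, by simp [regNorm, innerA], rfl⟩⟩
  refine ciSup_le ?_
  rintro ⟨_, f, hf, rfl⟩
  exact h f hf

theorem regNorm_mul_le (b f : ConvAlg α) : regNorm (b * f) ≤ regSeminorm α b * regNorm f := by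
  rcases (regNorm_nonneg f).eq_or_lt with h0 | h0
  · have := regNorm_mul_le_l1 b f
    rwa [← h0, mul_zero] at this ⊢
  · have h1 : regNorm (((regNorm f)⁻¹ : ℂ) • f) = 1 := by
      rw [regNorm_smul, norm_inv, Complex.norm_real, Real.norm_of_nonneg h0.le,
        inv_mul_cancel₀ h0.ne']
    have h2 : regNorm (b * ((regNorm f)⁻¹ : ℂ) • f) ≤ regSeminorm α b :=
      le_csSup bddAbove_regSeminormAt ⟨_, h1.le, rfl⟩ b
    rw [mul_smul_comm, regNorm_smul, norm_inv, Complex.norm_real, Real.norm_of_nonneg h0.le,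
      inv_mul_le_iff₀ h0] at h2
    rwa [mul_comm]

theorem isCStarSeminorm_regSeminorm : IsCStarSeminorm (regSeminorm α) := by
  have hmul : ∀ f h : ConvAlg α, regSeminorm α (f * h) ≤ regSeminorm α f * regSeminorm α h := by
    intro f h
    refine regSeminorm_le fun k hk => ?_
    rw [mul_assoc]
    refine (regNorm_mul_le f _).trans (mul_le_mul_of_nonneg_left ?_ (apply_nonneg _ _))
    exact (regNorm_mul_le h k).trans (mul_le_of_le_one_right (apply_nonneg _ _) hk)
  have hsq : ∀ f : ConvAlg α, regSeminorm α f ^ 2 ≤ regSeminorm α (star f * f) := by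
    intro f
    refine (Real.le_sqrt (apply_nonneg _ _) (apply_nonneg _ _)).1 (regSeminorm_le fun h hh => ?_)
    refine Real.le_sqrt_of_sq_le ((regNorm_mul_sq_le f h).trans ?_)
    refine (mul_le_of_le_one_left (regNorm_nonneg _) hh).trans ((regNorm_mul_le _ h).trans ?_)
    exact mul_le_of_le_one_right (apply_nonneg _ _) hh
  have hstar : ∀ f : ConvAlg α, regSeminorm α f ≤ regSeminorm α (star f) := by
    intro f
    rcases (apply_nonneg (regSeminorm α) f).eq_or_lt with h0 | h0
    · rw [← h0]; exact apply_nonneg _ _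
    · refine le_of_mul_le_mul_right ?_ h0
      rw [← sq]
      exact (hsq f).trans (hmul _ _)
  refine ⟨hmul, fun f => le_antisymm ((hmul _ _).trans ?_) (hsq f), fun f => ?_⟩
  · rw [sq]
    refine mul_le_mul_of_nonneg_right ?_ (apply_nonneg _ _)
    simpa using hstar (star f)
  · exact regSeminorm_le fun h hh =>
      (regNorm_mul_le_l1 f h).trans (mul_le_of_le_one_right (apply_nonneg _ _) hh)

theorem regNorm_cst {c : A} (hc : c ∈ α.fixedPoints) : regNorm (cst α c) = ‖c‖ := by
  rw [regNorm, innerA, star_cst hc, cst_mul_cst_of_mem _ hc, cst_apply,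
    CStarRing.norm_star_mul_self, Real.sqrt_mul_self (norm_nonneg _)]

/-- Test the regular representation of `cst c` on the vector `cst c*`, of norm `‖c‖`: the image is
`cst (c c*)`, of norm `‖c‖²`. -/
theorem norm_cst {c : A} (hc : c ∈ α.fixedPoints) : ‖cst α c‖ = ‖c‖ := by
  refine le_antisymm (norm_cst_le c) ?_
  have hsc := star_mem hc
  have h := regNorm_mul_le (cst α c) (cst α (star c))
  rw [cst_mul_cst_of_mem _ hsc, regNorm_cst (mul_mem hc hsc), regNorm_cst hsc,
    CStarRing.norm_self_mul_star, norm_star] at h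
  rcases (norm_nonneg c).eq_or_lt with h0 | h0
  · rw [← h0]; exact norm_nonneg _
  · exact (le_of_mul_le_mul_right h h0).trans (le_univSeminorm isCStarSeminorm_regSeminorm _)

end ConvAlg

/-! ### Ideals of the crossed product -/

section Ideals

set_option linter.unusedSectionVars false

variable {G : Type v} {A : Type u} [Group G] [TopologicalSpace G] [IsTopologicalGroup G]
  [CompactSpace G] [SecondCountableTopology G] [MeasurableSpace G] [BorelSpace G]
  [NonUnitalCStarAlgebra A] {α : CStarAction G A}

namespace ConvAlg

/-- The complex-valued function `s ↦ k(s₀⁻¹ s)`. -/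
def shift (k : C(G, ℝ)) (s₀ : G) : C(G, ℂ) := ⟨fun s => (k (s₀⁻¹ * s) : ℂ), by fun_prop⟩

theorem integral_norm_shift {k : C(G, ℝ)} (hk : ∀ s, 0 ≤ k s)
    (hk1 : ∫ s, k s ∂normHaar G = 1) (s₀ : G) : ∫ s, ‖shift k s₀ s‖ ∂normHaar G = 1 := by
  have : ∀ s, ‖shift k s₀ s‖ = k (s₀⁻¹ * s) := fun s => by
    simp [shift, abs_of_nonneg (hk _)]
  simp_rw [this]
  rw [integral_mul_left_eq_self (fun s => k s), hk1]

/-- A bump concentrated near `s₀` and tensored with `a` approximates the multiplier `a u_{s₀}`. -/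
theorem exists_nhds_tens_mul (s₀ : G) (a : A) (f : ConvAlg α) {ε : ℝ} (hε : 0 < ε) :
    ∃ U ∈ 𝓝 (1 : G), ∀ k : C(G, ℝ), (∀ s, 0 ≤ k s) → ∫ s, k s ∂normHaar G = 1 →
      (∀ s, k s ≠ 0 → s ∈ U) →
      ∀ g, ‖(tens α (shift k s₀) a * f) g - a * translate s₀ f g‖ ≤ ε := by
  let F : G → G → A := fun s g => a * translate (s₀ * s) f g
  have hF : Continuous (Function.uncurry F) := by
    refine continuous_const.mul (cont_act α (a := fun p : G × G => f ((s₀ * p.1)⁻¹ * p.2)) ?_ ?_)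
    · fun_prop
    · fun_prop
  refine ⟨_, eventually_norm_sub_le hF 1 hε, fun k hk hk1 hks g => ?_⟩
  have hFg : Continuous fun s => F s g := hF.comp (Continuous.prodMk_left g)
  have h := norm_integral_bump_sub_le hk hk1 hFg (a := F 1 g) (ε := ε) fun s hs => hks s hs g
  refine le_of_eq_of_le ?_ h
  rw [mul_apply, ← integral_mul_left_eq_self _ s₀]
  simp [F, shift, translate_apply, smul_mul_assoc]

/-- The substitution `s ↦ g s` turns the bump into `k(s⁻¹)`, hence the symmetry assumption on `k`.
-/
theorem exists_nhds_mul_tens (f : ConvAlg α) (a : A) {ε : ℝ} (hε : 0 < ε) :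
    ∃ U ∈ 𝓝 (1 : G), ∀ k : C(G, ℝ), (∀ s, 0 ≤ k s) → ∫ s, k s ∂normHaar G = 1 →
      (∀ s, k s ≠ 0 → s ∈ U) → (∀ s, k s⁻¹ = k s) →
      ∀ g, ‖(f * tens α (shift k 1) a) g - f g * α g a‖ ≤ ε := by
  let F : G → G → A := fun s g => f (g * s) * α (g * s) a
  have hF : Continuous (Function.uncurry F) := by
    refine Continuous.mul (by fun_prop) (cont_act α (k := fun p : G × G => p.2 * p.1)
      (by fun_prop) continuous_const)
  refine ⟨_, eventually_norm_sub_le hF 1 hε, fun k hk hk1 hks hki g => ?_⟩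
  have hFg : Continuous fun s => F s g := hF.comp (Continuous.prodMk_left g)
  have h := norm_integral_bump_sub_le hk hk1 hFg (a := F 1 g) (ε := ε) fun s hs => hks s hs g
  refine le_of_eq_of_le ?_ h
  have e : ∀ s, f (g * s) * α (g * s) (tens α (shift k 1) a ((g * s)⁻¹ * g)) =
      (k s : ℂ) • F s g := fun s => by
    rw [tens_apply, map_smul, mul_smul_comm,
      show shift k 1 ((g * s)⁻¹ * g) = (k s : ℂ) by simp [shift, hki]]
  rw [mul_apply, ← integral_mul_left_eq_self _ g]
  simp_rw [e]
  simp [F]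

end ConvAlg

namespace CrossedProduct

open ConvAlg

theorem norm_ofConv (f : ConvAlg α) : ‖(ofConv f : CrossedProduct α)‖ = ‖f‖ :=
  LinearIsometry.norm_map _ f

theorem mem_of_forall_norm_sub_le {S : Set (CrossedProduct α)} (hS : IsClosed S)
    {x : CrossedProduct α} (h : ∀ ε > 0, ∃ y ∈ S, ‖x - y‖ ≤ ε) : x ∈ S := by
  rw [← hS.closure_eq, Metric.mem_closure_iff]
  intro ε hε
  obtain ⟨y, hy, hxy⟩ := h (ε / 2) (half_pos hε)
  exact ⟨y, hy, by rw [dist_eq_norm]; linarith⟩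

/-- The universal norm is at most the `L¹`-norm, hence at most the supremum norm, so uniform
approximation on `G` suffices. -/
theorem ofConv_mem_of_forall {S : Set (CrossedProduct α)} (hS : IsClosed S)
    {f : ConvAlg α} (h : ∀ ε > 0, ∃ f', ofConv f' ∈ S ∧ ∀ g, ‖f g - f' g‖ ≤ ε) :
    ofConv f ∈ S :=
  mem_of_forall_norm_sub_le hS fun ε hε => by
    obtain ⟨f', hf', h'⟩ := h ε hε
    refine ⟨_, hf', ?_⟩
    rw [← map_sub, norm_ofConv]
    exact norm_le_of_forall_norm_apply_le h'

variable (α) in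
/-- The embedding of `A^α` in `A ⋊_α G` by constant functions. -/
def fixHom : α.fixedPoints →ₙ+* CrossedProduct α where
  toFun c := ofConv (cst α c)
  map_zero' := map_zero ofConv
  map_add' c d := map_add ofConv (cst α c) (cst α d)
  map_mul' c d := by rw [← ofConv_mul, cst_mul_cst_of_mem _ d.2]; rfl

theorem fixHom_apply (c : α.fixedPoints) : fixHom α c = ofConv (cst α c) := rfl

theorem isometry_fixHom : Isometry (fixHom α) :=
  AddMonoidHomClass.isometry_of_norm _ fun c => (norm_ofConv _).trans (norm_cst c.2)

/-- Closedness of the image lets statements about the corner pass from `C(G, A)` to its completion.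
-/
theorem isClosedEmbedding_fixHom : IsClosedEmbedding (fixHom α) := by
  have : CompleteSpace α.fixedPoints := α.isClosed_fixedPoints.completeSpace_coe
  exact isometry_fixHom.isClosedEmbedding

/-- The corner of `A ⋊_α G` defined by the constant functions is `A^α`. -/
theorem fixHom_mul_mul_fixHom_mem (c d : α.fixedPoints) (y : CrossedProduct α) :
    fixHom α c * y * fixHom α d ∈ Set.range (fixHom α) := by
  induction y using induction₁ with
  | hp =>
    exact isClosedEmbedding_fixHom.isClosed_range.preimage
      ((continuous_const.mul continuous_id).mul continuous_const)
  | ih f =>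
    refine ⟨c * ⟨_, α.avg_mem ((∫ s, f s ∂normHaar G) * d)⟩, ?_⟩
    simp only [fixHom_apply]
    rw [← ofConv_mul, ← ofConv_mul, cst_mul_mul_cst _ _ d.2]
    rfl

theorem continuous_ofConv_cst : Continuous fun c : A => (ofConv (cst α c) : CrossedProduct α) :=
  (LipschitzWith.of_dist_le_mul (K := 1) fun c d => by
    rw [dist_eq_norm, ← map_sub, norm_ofConv, ← cst_sub, NNReal.coe_one, one_mul, dist_eq_norm]
    exact norm_cst_le _).continuous

variable {I : TwoSidedIdeal (CrossedProduct α)}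

theorem ofConv_sum_mem {n : ℕ} {f : Fin n → ConvAlg α} (h : ∀ i, ofConv (f i) ∈ I) :
    ofConv (∑ i, f i) ∈ I := by
  rw [map_sum]
  exact sum_mem fun i _ => h i

variable [T2Space G]

theorem ofConv_lsmul_translate_mem (hI : IsClosed (I : Set (CrossedProduct α))) {f : ConvAlg α}
    (hf : ofConv f ∈ I) (a : A) (s : G) : ofConv (lsmul a (translate s f)) ∈ I := by
  refine ofConv_mem_of_forall hI fun ε hε => ?_
  obtain ⟨U, hU, h⟩ := exists_nhds_tens_mul s a f hε
  obtain ⟨k, hk, hk1, hkU, -⟩ := exists_bump hU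
  refine ⟨tens α (shift k s) a * f, ?_, fun g => ?_⟩
  · rw [ofConv_mul]
    exact I.mul_mem_left _ _ hf
  · rw [norm_sub_rev]
    exact h k hk hk1 hkU g

theorem ofConv_lsmul_mem (hI : IsClosed (I : Set (CrossedProduct α))) {f : ConvAlg α}
    (hf : ofConv f ∈ I) (a : A) : ofConv (lsmul a f) ∈ I := by
  have h := ofConv_lsmul_translate_mem hI hf a 1
  have e : translate 1 f = f := by ext g; simp [ConvAlg.translate_apply]
  rwa [e] at h

theorem ofConv_rsmul_mem (hI : IsClosed (I : Set (CrossedProduct α))) {f : ConvAlg α}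
    (hf : ofConv f ∈ I) (b : A) : ofConv (rsmul f b) ∈ I := by
  refine ofConv_mem_of_forall hI fun ε hε => ?_
  obtain ⟨U, hU, h⟩ := exists_nhds_mul_tens f b hε
  obtain ⟨k, hk, hk1, hkU, hki⟩ := exists_bump hU
  refine ⟨f * tens α (shift k 1) b, ?_, fun g => ?_⟩
  · rw [ofConv_mul]
    exact I.mul_mem_right _ _ hf
  · rw [norm_sub_rev]
    exact h k hk hk1 hkU hki g

/-- Multiplying `cst c` by `a` on the left and `b` on the right gives `g ↦ a c α_g(b)`, exactly the
functions of the saturation lemma. -/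
theorem ofConv_tens_mem (hA : IsSigmaUnital A) (hα : α.HasRokhlinProperty)
    (hI : IsClosed (I : Set (CrossedProduct α))) {c : A} (hc : ofConv (cst α c) ∈ I)
    (k : C(G, ℂ)) : ofConv (tens α k c) ∈ I := by
  refine ofConv_mem_of_forall hI fun ε hε => ?_
  obtain ⟨m, a, b, h⟩ := hα.exists_approx hA c k hε
  refine ⟨∑ i, rsmul (lsmul (a i) (cst α c)) (b i),
    ofConv_sum_mem fun i => ofConv_rsmul_mem hI (ofConv_lsmul_mem hI hc _) _, fun g => ?_⟩
  simpa using h g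

theorem ofConv_mem_of_forall_cst (hA : IsSigmaUnital A) (hα : α.HasRokhlinProperty)
    (hI : IsClosed (I : Set (CrossedProduct α))) {f : ConvAlg α}
    (hf : ∀ g, ofConv (cst α (f g)) ∈ I) : ofConv f ∈ I := by
  refine ofConv_mem_of_forall hI fun ε hε => ?_
  obtain ⟨m, ρ, x, h⟩ := exists_finite_approx f.cont hε
  refine ⟨∑ i, tens α (ρ i) (f (x i)),
    ofConv_sum_mem fun i => ofConv_tens_mem hA hα hI (hf _) _, fun g => ?_⟩
  simpa using h g

/-- Right multiplication by `b` twists by `α_g` and leaves the constants. The twist is undone by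
writing `c b = c α_g(α_{g⁻¹}(b))` and approximating `g ↦ α_{g⁻¹}(b)` by finite sums, whose scalar
coefficients are absorbed by `ofConv_tens_mem`. -/
theorem ofConv_cst_mul_mem (hA : IsSigmaUnital A) (hα : α.HasRokhlinProperty)
    (hI : IsClosed (I : Set (CrossedProduct α))) {c : A} (hc : ofConv (cst α c) ∈ I) (b : A) :
    ofConv (cst α (c * b)) ∈ I := by
  refine ofConv_mem_of_forall hI fun ε hε => ?_
  have hε' : 0 < ε / (‖c‖ + 1) := by positivity
  obtain ⟨m, ρ, x, h⟩ := exists_finite_approx (F := fun g => α g⁻¹ b)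
    ((α.continuous_apply b).comp continuous_inv) hε'
  refine ⟨∑ i, rsmul (tens α (ρ i) c) (α (x i)⁻¹ b),
    ofConv_sum_mem fun i => ofConv_rsmul_mem hI (ofConv_tens_mem hA hα hI hc _) _, fun g => ?_⟩
  have e : cst α (c * b) g - (∑ i, rsmul (tens α (ρ i) c) (α (x i)⁻¹ b)) g =
      c * α g (α g⁻¹ b - ∑ i, ρ i g • α (x i)⁻¹ b) := by
    rw [map_sub, α.apply_inv_apply, mul_sub, map_sum, Finset.mul_sum]
    simp [map_smul, mul_smul_comm, smul_mul_assoc]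
  rw [e]
  refine (norm_mul_le _ _).trans ?_
  rw [α.norm_apply]
  calc ‖c‖ * ‖α g⁻¹ b - ∑ i, ρ i g • α (x i)⁻¹ b‖ ≤ (‖c‖ + 1) * (ε / (‖c‖ + 1)) := by
        gcongr
        · linarith
        · exact h g
    _ = ε := mul_div_cancel₀ _ (by positivity)

/-- The ideal of all `c ∈ A` for which the constant function `c` lies in `I`. -/
def coeffIdeal (hA : IsSigmaUnital A) (hα : α.HasRokhlinProperty)
    (hI : IsClosed (I : Set (CrossedProduct α))) : TwoSidedIdeal A :=
  TwoSidedIdeal.mk' {c | ofConv (cst α c) ∈ I}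
    (by change ofConv (0 : ConvAlg α) ∈ I; rw [map_zero]; exact I.zero_mem)
    (fun {x y} hx hy => by
      change ofConv (cst α x + cst α y) ∈ I; rw [map_add]; exact I.add_mem hx hy)
    (fun {x} hx => by
      change ofConv (-cst α x) ∈ I; rw [map_neg]; exact I.neg_mem hx)
    (fun {x _} hy => ofConv_lsmul_mem hI hy x)
    (fun {_ y} hx => ofConv_cst_mul_mem hA hα hI hx y)

section

variable {hA : IsSigmaUnital A} {hα : α.HasRokhlinProperty}
  {hI : IsClosed (I : Set (CrossedProduct α))}

theorem mem_coeffIdeal {c : A} : c ∈ coeffIdeal hA hα hI ↔ ofConv (cst α c) ∈ I :=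
  TwoSidedIdeal.mem_mk' _ _ _ _ _ _ _

theorem isClosed_coeffIdeal : IsClosed (coeffIdeal hA hα hI : Set A) := by
  have : (coeffIdeal hA hα hI : Set A) = (fun c => ofConv (cst α c)) ⁻¹' (I : Set _) :=
    Set.ext fun c => mem_coeffIdeal
  rw [this]
  exact hI.preimage continuous_ofConv_cst

/-- Translating `cst c` by `s` gives `cst (α_s(c))`; the translation is available only after
multiplication by an element of `A`, so an approximate unit is inserted. -/
theorem isInvariant_coeffIdeal : α.IsInvariant (coeffIdeal hA hα hI : Set A) := by
  intro s c hc
  obtain ⟨e, -, -, hel, -⟩ := CStarAction.exists_invariant_approximateUnit hA α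
  refine isClosed_coeffIdeal.mem_of_tendsto (hel (α s c)) (.of_forall fun n => ?_)
  exact mem_coeffIdeal.2 (ofConv_lsmul_translate_mem hI (mem_coeffIdeal.1 hc) (e n) s)

theorem ofIdeal_coeffIdeal_subset : ofIdeal α (coeffIdeal hA hα hI) ⊆ I := by
  refine closure_minimal ?_ hI
  rintro _ ⟨f, hf, rfl⟩
  exact ofConv_mem_of_forall_cst hA hα hI fun g => mem_coeffIdeal.1 (hf g)

end

end CrossedProduct

end Ideals

/-! ### The ideal correspondence. -/

section Correspondence

set_option linter.unusedSectionVars false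

variable {G : Type v} {A : Type u} [Group G] [TopologicalSpace G] [IsTopologicalGroup G]
  [CompactSpace G] [SecondCountableTopology G] [MeasurableSpace G] [BorelSpace G]
  [NonUnitalCStarAlgebra A] {α : CStarAction G A} [T2Space G]

namespace CrossedProduct

open ConvAlg

/-- A bump near the identity tensored with an invariant approximate unit. The coefficient is a cube
so that it later splits into three constants: one for each outer factor and one for the corner. -/
theorem exists_approximateUnit (hA : IsSigmaUnital A) (x : CrossedProduct α) {ε : ℝ} (hε : 0 < ε) :
    ∃ (k : C(G, ℂ)) (e : A), e ∈ α.fixedPoints ∧ ‖tens α k (e * e * e)‖ ≤ 1 ∧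
      ‖ofConv (tens α k (e * e * e)) * x - x‖ ≤ ε ∧
      ‖x * ofConv (tens α k (e * e * e)) - x‖ ≤ ε := by
  obtain ⟨e, hefix, he1, hel, her⟩ := CStarAction.exists_invariant_approximateUnit hA α
  have he3 : ∀ n, ‖e n * e n * e n‖ ≤ 1 := fun n => by
    refine (norm_mul_le_of_le (norm_mul_le_of_le (he1 n) (he1 n)) (he1 n)).trans ?_
    norm_num
  have hl3 : ∀ a, Tendsto (fun n => e n * e n * e n * a) atTop (𝓝 a) := fun a =>
    (tendsto_contraction_mul he1 (hel a) (tendsto_contraction_mul he1 (hel a) (hel a))).congr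
      fun n => by simp only [mul_assoc]
  have hr3 : ∀ a, Tendsto (fun n => a * (e n * e n * e n)) atTop (𝓝 a) := fun a =>
    (tendsto_mul_contraction he1 (her a) (tendsto_mul_contraction he1 (her a) (her a))).congr
      fun n => by simp only [mul_assoc]
  obtain ⟨_, hf, f, rfl⟩ := Metric.dense_iff.1 denseRange_ofConv x (ε / 3) (by positivity)
  rw [Metric.mem_ball, dist_eq_norm] at hf
  have hK : IsCompact (Set.range f) := isCompact_range f.cont
  have hε6 : 0 < ε / 6 := by positivity
  obtain ⟨n, hnl, hnr⟩ := ((eventually_norm_sub_le_of_isCompact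
    (u := fun n a => e n * e n * e n * a) (fun n a b => by
      rw [← mul_sub]; exact (norm_mul_le_of_le (he3 n) le_rfl).trans (one_mul _).le)
    hl3 hK hε6).and (eventually_norm_sub_le_of_isCompact
    (u := fun n a => a * (e n * e n * e n)) (fun n a b => by
      rw [← sub_mul]; exact (norm_mul_le_of_le le_rfl (he3 n)).trans (mul_one _).le)
    hr3 hK hε6)).exists
  set d := e n * e n * e n with hd
  have hdfix : d ∈ α.fixedPoints := mul_mem (mul_mem (hefix n) (hefix n)) (hefix n)
  obtain ⟨U, hU, hUk⟩ := exists_nhds_tens_mul 1 d f hε6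
  obtain ⟨V, hV, hVk⟩ := exists_nhds_mul_tens f d hε6
  obtain ⟨k, hk, hk1, hks, hki⟩ := exists_bump (Filter.inter_mem hU hV)
  have hn1 : ‖tens α (shift k 1) d‖ ≤ 1 := by
    refine (norm_tens_le _ _).trans ?_
    rw [integral_norm_shift hk hk1, one_mul]
    exact he3 n
  have hL : ‖tens α (shift k 1) d * f - f‖ ≤ ε / 3 :=
    norm_le_of_forall_norm_apply_le fun g => by
      have h1 := hUk k hk hk1 (fun s hs => (hks s hs).1) g
      have e1 : translate 1 f g = f g := by simp [ConvAlg.translate_apply]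
      rw [e1] at h1
      have h2 := norm_add_le ((tens α (shift k 1) d * f) g - d * f g) (d * f g - f g)
      rw [sub_add_sub_cancel] at h2
      rw [ConvAlg.sub_apply]
      linarith [hnl (f g) ⟨g, rfl⟩]
  have hR : ‖f * tens α (shift k 1) d - f‖ ≤ ε / 3 :=
    norm_le_of_forall_norm_apply_le fun g => by
      have h1 := hVk k hk hk1 (fun s hs => (hks s hs).2) hki g
      rw [hdfix g] at h1
      have h2 := norm_add_le ((f * tens α (shift k 1) d) g - f g * d) (f g * d - f g)
      rw [sub_add_sub_cancel] at h2
      rw [ConvAlg.sub_apply]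
      linarith [hnr (f g) ⟨g, rfl⟩]
  rw [← norm_ofConv, map_sub, ofConv_mul] at hL hR
  refine ⟨shift k 1, e n, hefix n, hn1, ?_, ?_⟩
  all_goals
    rw [← hd]
    rw [← norm_ofConv] at hn1
    set u : CrossedProduct α := ofConv (tens α (shift k 1) d)
    set y : CrossedProduct α := ofConv f
  · have e1 : u * x - x = (u * y - y) - u * (y - x) + (y - x) := by rw [mul_sub]; abel
    have n1 : ‖u * (y - x)‖ ≤ 1 * (ε / 3) := norm_mul_le_of_le hn1 hf.le
    rw [e1]
    refine (norm_add_le_of_le (norm_sub_le_of_le hL n1) hf.le).trans ?_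
    linarith
  · have e1 : x * u - x = (y * u - y) - (y - x) * u + (y - x) := by rw [sub_mul]; abel
    have n1 : ‖(y - x) * u‖ ≤ (ε / 3) * 1 := norm_mul_le_of_le hf.le hn1
    rw [e1]
    refine (norm_add_le_of_le (norm_sub_le_of_le hR n1) hf.le).trans ?_
    linarith

/-- Compress `x` to `T x T`, where `T` approximates a two-sided unit for `x` and factors through the
corner. -/
theorem subset_ofIdeal_coeffIdeal {I : TwoSidedIdeal (CrossedProduct α)} (hA : IsSigmaUnital A)
    (hα : α.HasRokhlinProperty) (hI : IsClosed (I : Set (CrossedProduct α))) :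
    (I : Set (CrossedProduct α)) ⊆ ofIdeal α (coeffIdeal hA hα hI) := by
  intro x hx
  have hZ : IsClosed (ofIdeal α (coeffIdeal hA hα hI)) := isClosed_closure
  have key : ∀ (m : ℕ) (a b : Fin m → A) (e : α.fixedPoints),
      let T : ConvAlg α := ∑ i, rsmul (lsmul (a i) (cst α ((e : A) * e * e))) (b i)
      ofConv T * x * ofConv T ∈ ofIdeal α (coeffIdeal hA hα hI) := by
    intro m a b e T
    let L : Fin m → ConvAlg α := fun i => lsmul (a i) (cst α (e : A))
    let R : Fin m → ConvAlg α := fun i => rsmul (cst α (e : A)) (b i)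
    have hT : ofConv T = ∑ i, ofConv (L i) * fixHom α e * ofConv (R i) := by
      simp only [T, map_sum, fixHom_apply, ← ofConv_mul, L, R]
      refine Finset.sum_congr rfl fun i _ => ?_
      rw [mul_rsmul, lsmul_mul, lsmul_mul, cst_mul_cst_of_mem _ e.2, cst_mul_cst_of_mem _ e.2]
    -- The middle part of each term of `T x T` lies both in the corner and in `I`, so it is a
    -- constant with value in `A^α` and in the coefficient ideal.
    choose d hd using fun i j => fixHom_mul_mul_fixHom_mem e e (ofConv (R i) * x * ofConv (L j))
    have hdJ : ∀ i j, (d i j : A) ∈ coeffIdeal hA hα hI := fun i j => by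
      refine mem_coeffIdeal.2 ?_
      rw [← fixHom_apply, hd]
      exact I.mul_mem_right _ _ (I.mul_mem_left _ _ (I.mul_mem_right _ _ (I.mul_mem_left _ _ hx)))
    have e1 : ofConv T * x * ofConv T =
        ofConv (∑ i, ∑ j, L i * cst α (d i j : A) * R j) := by
      rw [hT, Finset.sum_mul, Finset.sum_mul, map_sum]
      refine Finset.sum_congr rfl fun i _ => ?_
      rw [Finset.mul_sum, map_sum]
      refine Finset.sum_congr rfl fun j _ => ?_
      rw [ofConv_mul, ofConv_mul, ← fixHom_apply, hd]
      simp only [mul_assoc]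
    rw [e1]
    refine subset_closure ⟨_, fun g => ?_, rfl⟩
    rw [ConvAlg.sum_apply]
    refine sum_mem fun i _ => ?_
    rw [ConvAlg.sum_apply]
    refine sum_mem fun j _ => ?_
    rw [mul_rsmul, lsmul_mul, lsmul_mul, cst_mul_cst_of_mem _ (d i j).2, cst_mul_cst_of_mem _ e.2]
    exact TwoSidedIdeal.mul_mem_right _ _ _ (TwoSidedIdeal.mul_mem_left _ _ _
      (TwoSidedIdeal.mul_mem_right _ _ _ (TwoSidedIdeal.mul_mem_left _ _ _ (hdJ i j))))
  refine mem_of_forall_norm_sub_le hZ fun ε hε => ?_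
  obtain ⟨k, e, he, hu1, hul, hur⟩ := exists_approximateUnit hA x (ε := ε / 4) (by positivity)
  set u : CrossedProduct α := ofConv (tens α k (e * e * e)) with hu
  have hun : ‖u‖ ≤ 1 := by rwa [hu, norm_ofConv]
  -- The bound `1` gives `‖T‖ ≤ 2`; the other bound makes the four error terms at most `ε/4 + ε/4 +
  -- ε/8 + ε/4`.
  let δ : ℝ := min 1 (ε / (8 * (‖x‖ + 1)))
  have hδ : 0 < δ := lt_min one_pos (by positivity)
  obtain ⟨m, a, b, hab⟩ := hα.exists_approx hA (e * e * e) k hδ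
  refine ⟨_, key m a b ⟨e, he⟩, ?_⟩
  set T : CrossedProduct α :=
    ofConv (∑ i, rsmul (lsmul (a i) (cst α (e * e * e))) (b i)) with hT
  have hTu : ‖u - T‖ ≤ δ := by
    rw [hu, hT, ← map_sub, norm_ofConv]
    refine norm_le_of_forall_norm_apply_le fun g => ?_
    simpa using hab g
  have hTn : ‖T‖ ≤ 2 := by
    have h1 := norm_sub_le u (u - T)
    rw [sub_sub_cancel] at h1
    have := min_le_left 1 (ε / (8 * (‖x‖ + 1)))
    linarith
  have hδx : δ * ‖x‖ ≤ ε / 8 := by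
    calc δ * ‖x‖ ≤ ε / (8 * (‖x‖ + 1)) * (‖x‖ + 1) := by
          gcongr
          · exact min_le_right _ _
          · linarith
      _ = ε / 8 := by field_simp
  have e1 : x - T * x * T = -(u * x - x) - u * (x * u - x) + u * x * (u - T) + (u - T) * (x * T) := by
    noncomm_ring
  change ‖x - T * x * T‖ ≤ ε
  rw [e1]
  have n1 : ‖u * (x * u - x)‖ ≤ 1 * (ε / 4) := norm_mul_le_of_le hun hur
  have n2 : ‖u * x * (u - T)‖ ≤ 1 * ‖x‖ * δ :=
    norm_mul_le_of_le (norm_mul_le_of_le hun le_rfl) hTu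
  have n3 : ‖(u - T) * (x * T)‖ ≤ δ * (‖x‖ * 2) :=
    norm_mul_le_of_le hTu (norm_mul_le_of_le le_rfl hTn)
  have n4 : ‖-(u * x - x) - u * (x * u - x) + u * x * (u - T) + (u - T) * (x * T)‖ ≤
      ‖u * x - x‖ + ‖u * (x * u - x)‖ + ‖u * x * (u - T)‖ + ‖(u - T) * (x * T)‖ := by
    refine (norm_add_le _ _).trans ?_
    gcongr
    refine (norm_add_le _ _).trans ?_
    gcongr
    refine (norm_sub_le _ _).trans ?_
    rw [norm_neg]
  nlinarith

theorem eq_ofIdeal_coeffIdeal {I : TwoSidedIdeal (CrossedProduct α)} (hA : IsSigmaUnital A)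
    (hα : α.HasRokhlinProperty) (hI : IsClosed (I : Set (CrossedProduct α))) :
    (I : Set (CrossedProduct α)) = ofIdeal α (coeffIdeal hA hα hI) :=
  (subset_ofIdeal_coeffIdeal hA hα hI).antisymm ofIdeal_coeffIdeal_subset

/-- The ideal of `A ⋊_α G` generated by an ideal of the corner `A^α`. -/
def cornerIdeal (I : TwoSidedIdeal α.fixedPoints) : TwoSidedIdeal (CrossedProduct α) :=
  TwoSidedIdeal.mk' {x | ∀ (y z : CrossedProduct α) (c d : α.fixedPoints),
      fixHom α c * (y * x * z) * fixHom α d ∈ fixHom α '' I}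
    (fun y z c d => ⟨0, I.zero_mem, by simp⟩)
    (fun {x x'} hx hx' y z c d => by
      obtain ⟨p, hp, hp'⟩ := hx y z c d
      obtain ⟨q, hq, hq'⟩ := hx' y z c d
      exact ⟨p + q, I.add_mem hp hq, by rw [map_add, hp', hq']; noncomm_ring⟩)
    (fun {x} hx y z c d => by
      obtain ⟨p, hp, hp'⟩ := hx y z c d
      exact ⟨-p, I.neg_mem hp, by rw [map_neg, hp']; noncomm_ring⟩)
    (fun {w x} hx y z c d => by
      have := hx (y * w) z c d
      rwa [mul_assoc y w x] at this)
    (fun {x w} hx y z c d => by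
      have := hx y (w * z) c d
      rwa [← mul_assoc (y * x) w z, mul_assoc y x w] at this)

theorem mem_cornerIdeal {I : TwoSidedIdeal α.fixedPoints} {x : CrossedProduct α} :
    x ∈ cornerIdeal I ↔ ∀ (y z : CrossedProduct α) (c d : α.fixedPoints),
      fixHom α c * (y * x * z) * fixHom α d ∈ fixHom α '' I :=
  TwoSidedIdeal.mem_mk' _ _ _ _ _ _ _

theorem isClosed_cornerIdeal {I : TwoSidedIdeal α.fixedPoints}
    (hI : IsClosed (I : Set α.fixedPoints)) :
    IsClosed (cornerIdeal I : Set (CrossedProduct α)) := by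
  have : (cornerIdeal I : Set (CrossedProduct α)) =
      ⋂ (y : CrossedProduct α) (z : CrossedProduct α) (c : α.fixedPoints) (d : α.fixedPoints),
        (fun x => fixHom α c * (y * x * z) * fixHom α d) ⁻¹' (fixHom α '' I) := by
    ext x
    simp only [Set.mem_iInter]
    exact mem_cornerIdeal
  rw [this]
  exact isClosed_iInter fun y => isClosed_iInter fun z => isClosed_iInter fun c =>
    isClosed_iInter fun d =>
      (isClosedEmbedding_fixHom.isClosedMap _ hI).preimage ((continuous_const.mul
        ((continuous_const.mul continuous_id).mul continuous_const)).mul continuous_const)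

/-- No ideal of `A^α` is lost in passing to the crossed product. If `fixHom c` lies in the corner
ideal, testing against an approximate unit of `A^α` recovers `c`. Conversely, replacing `c` by `E_m
c E_n` compresses the arbitrary factors `y` and `z` into the corner, where `I` is an ideal. -/
theorem fixHom_mem_cornerIdeal (hA : IsSigmaUnital A) {I : TwoSidedIdeal α.fixedPoints}
    (hI : IsClosed (I : Set α.fixedPoints)) {c : α.fixedPoints} :
    fixHom α c ∈ cornerIdeal I ↔ c ∈ I := by
  obtain ⟨e, hefix, -, hel, her⟩ := CStarAction.exists_invariant_approximateUnit hA α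
  let E : ℕ → α.fixedPoints := fun n => ⟨e n, hefix n⟩
  have hEl : ∀ c : α.fixedPoints, Tendsto (fun n => E n * c) atTop (𝓝 c) := fun c =>
    tendsto_subtype_rng.2 (hel c)
  have hEr : ∀ c : α.fixedPoints, Tendsto (fun n => c * E n) atTop (𝓝 c) := fun c =>
    tendsto_subtype_rng.2 (her c)
  have hP := isClosedEmbedding_fixHom.isClosedMap _ hI
  have hcont : Continuous (fixHom α) := isometry_fixHom.continuous
  constructor
  · intro h
    have hmem : ∀ i j m n, E i * (E j * c * E m) * E n ∈ I := fun i j m n => by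
      obtain ⟨p, hp, hp'⟩ := mem_cornerIdeal.1 h (fixHom α (E j)) (fixHom α (E m)) (E i) (E n)
      simp only [← map_mul] at hp'
      rwa [← isometry_fixHom.injective hp']
    have h1 : ∀ j m, E j * c * E m ∈ I := fun j m =>
      hI.mem_of_tendsto (hEl _) (.of_forall fun i =>
        hI.mem_of_tendsto (hEr _) (.of_forall fun n => hmem i j m n))
    exact hI.mem_of_tendsto (hEl _) (.of_forall fun j =>
      hI.mem_of_tendsto (hEr _) (.of_forall fun m => h1 j m))
  · intro hc
    refine mem_cornerIdeal.2 fun y z p q => ?_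
    have h1 : ∀ m n, fixHom α p * (y * fixHom α (E m * c * E n) * z) * fixHom α q ∈
        fixHom α '' I := fun m n => by
      obtain ⟨r, hr⟩ := fixHom_mul_mul_fixHom_mem p (E m) y
      obtain ⟨s, hs⟩ := fixHom_mul_mul_fixHom_mem (E n) q z
      refine ⟨r * c * s, I.mul_mem_right _ _ (I.mul_mem_left _ _ hc), ?_⟩
      rw [map_mul, map_mul, hr, hs, map_mul, map_mul]
      simp only [mul_assoc]
    have hF : Continuous fun w : α.fixedPoints =>
        fixHom α p * (y * fixHom α w * z) * fixHom α q :=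
      (continuous_const.mul ((continuous_const.mul hcont).mul continuous_const)).mul
        continuous_const
    have h2 : ∀ m, fixHom α p * (y * fixHom α (E m * c) * z) * fixHom α q ∈ fixHom α '' I :=
      fun m => hP.mem_of_tendsto ((hF.tendsto _).comp (hEr (E m * c))) (.of_forall fun n => h1 m n)
    exact hP.mem_of_tendsto ((hF.tendsto _).comp (hEl c)) (.of_forall h2)

end CrossedProduct

end Correspondence

end

/-! ### The main theorem -/

theorem mainTheorem3 {G : Type v} {A : Type u} [Group G] [TopologicalSpace G]
    [IsTopologicalGroup G] [CompactSpace G] [T2Space G] [SecondCountableTopology G]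
    [MeasurableSpace G] [BorelSpace G] [NonUnitalCStarAlgebra A]
    (hA : IsSigmaUnital A) (α : CStarAction G A) (hα : α.HasRokhlinProperty) :
    (∀ I : TwoSidedIdeal α.fixedPoints, IsClosed (I : Set α.fixedPoints) →
      ∃ J : TwoSidedIdeal A, IsClosed (J : Set A) ∧ α.IsInvariant (J : Set A) ∧
        ((↑) '' (I : Set α.fixedPoints) : Set A) = (J : Set A) ∩ (α.fixedPoints : Set A)) ∧
    (∀ I : TwoSidedIdeal (CrossedProduct α), IsClosed (I : Set (CrossedProduct α)) →
      ∃ J : TwoSidedIdeal A, IsClosed (J : Set A) ∧ α.IsInvariant (J : Set A) ∧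
        (I : Set (CrossedProduct α)) = CrossedProduct.ofIdeal α J) ∧
    (IsTopSimple A → IsTopSimple α.fixedPoints ∧ IsTopSimple (CrossedProduct α)) := by
  obtain ⟨e, hefix, -, hel, -⟩ := CStarAction.exists_invariant_approximateUnit hA α
  have part1 : ∀ I : TwoSidedIdeal α.fixedPoints, IsClosed (I : Set α.fixedPoints) →
      ∃ J : TwoSidedIdeal A, IsClosed (J : Set A) ∧ α.IsInvariant (J : Set A) ∧
        ((↑) '' (I : Set α.fixedPoints) : Set A) = (J : Set A) ∩ (α.fixedPoints : Set A) := by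
    intro I hI
    have hK := CrossedProduct.isClosed_cornerIdeal hI
    refine ⟨CrossedProduct.coeffIdeal hA hα hK, CrossedProduct.isClosed_coeffIdeal,
      CrossedProduct.isInvariant_coeffIdeal, ?_⟩
    have key : ∀ c : α.fixedPoints, (c : A) ∈ CrossedProduct.coeffIdeal hA hα hK ↔ c ∈ I :=
      fun c => CrossedProduct.mem_coeffIdeal.trans (CrossedProduct.fixHom_mem_cornerIdeal hA hI)
    ext a
    constructor
    · rintro ⟨c, hc, rfl⟩
      exact ⟨(key c).2 hc, c.2⟩
    · rintro ⟨ha, hfix⟩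
      exact ⟨⟨a, hfix⟩, (key ⟨a, hfix⟩).1 ha, rfl⟩
  have part2 : ∀ I : TwoSidedIdeal (CrossedProduct α), IsClosed (I : Set (CrossedProduct α)) →
      ∃ J : TwoSidedIdeal A, IsClosed (J : Set A) ∧ α.IsInvariant (J : Set A) ∧
        (I : Set (CrossedProduct α)) = CrossedProduct.ofIdeal α J := fun I hI =>
    ⟨CrossedProduct.coeffIdeal hA hα hI, CrossedProduct.isClosed_coeffIdeal,
      CrossedProduct.isInvariant_coeffIdeal, CrossedProduct.eq_ofIdeal_coeffIdeal hA hα hI⟩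
  refine ⟨part1, part2, fun ⟨hnt, hsimple⟩ => ?_⟩
  -- The invariant approximate unit lies in `A^α`; were it zero, every element of `A` would vanish.
  have hfnt : Nontrivial α.fixedPoints := by
    obtain ⟨a, ha⟩ := exists_ne (0 : A)
    by_contra hs
    rw [not_nontrivial_iff_subsingleton] at hs
    have he : ∀ n, e n = 0 := fun n =>
      congrArg Subtype.val (Subsingleton.elim (⟨e n, hefix n⟩ : α.fixedPoints) 0)
    have h := hel a
    simp only [he, zero_mul] at h
    exact ha (tendsto_nhds_unique h tendsto_const_nhds)
  refine ⟨⟨hfnt, fun I hI => ?_⟩, CrossedProduct.isometry_fixHom.injective.nontrivial,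
    fun I hI => ?_⟩
  · obtain ⟨J, hJ, -, h⟩ := part1 I hI
    have key : ∀ c : α.fixedPoints, c ∈ I ↔ (c : A) ∈ J := fun c => by
      have := Set.ext_iff.1 h c
      simpa using this
    rcases hsimple J hJ with rfl | rfl
    · exact .inl (TwoSidedIdeal.ext fun c => by
        rw [key, TwoSidedIdeal.mem_bot, TwoSidedIdeal.mem_bot]; exact ZeroMemClass.coe_eq_zero)
    · exact .inr (TwoSidedIdeal.ext fun c => by simp [key, TwoSidedIdeal.mem_top])
  · obtain ⟨J, hJ, -, h⟩ := part2 I hI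
    rcases hsimple J hJ with rfl | rfl
    · refine .inl (SetLike.coe_injective (h.trans ?_))
      have : {f : ConvAlg α | ∀ g, f g ∈ (⊥ : TwoSidedIdeal A)} = {0} := by
        ext f
        simp only [TwoSidedIdeal.mem_bot, Set.mem_singleton_iff]
        exact ⟨fun hf => ConvAlg.ext hf, fun hf g => by rw [hf]; rfl⟩
      rw [CrossedProduct.ofIdeal, this, Set.image_singleton, map_zero, closure_singleton]
      rfl
    · refine .inr (SetLike.coe_injective (h.trans ?_))
      have : {f : ConvAlg α | ∀ g, f g ∈ (⊤ : TwoSidedIdeal A)} = Set.univ :=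
        Set.eq_univ_of_forall fun f g => TwoSidedIdeal.mem_top A
      rw [CrossedProduct.ofIdeal, this, Set.image_univ]
      exact CrossedProduct.denseRange_ofConv.closure_range
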